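/- For an entire function $f$ and $r\ge 0$ let $M(r)=M(r,f)=\max_{|z|=r}|f(z)|$ and $m(r)=m(r,f)=\min_{|z|=r}|f(z)|$, let $m^n$ denote the $n$-th iterate of the real function $m$, and let $n(r,f)$ be the number of zeros of $f$ in $\{z:|z|\le r\}$, counted according to multiplicity. **Theorem 2.3.** Let $\varepsilon$ be a real function and put $k(r)=\varepsilon(r)\log r$. Suppose that, for all sufficiently large $r$, $\varepsilon(r)$ is positive and decreasing and $k(r)$ is increasing (both in the weak sense), that $\varepsilon(r)\to 0$ as $r\to\infty$, and that there exist $C>1$, $d>1$ and $r_2>0$ such that $$k(r)\ge C\,k\big((\log r)^{2d}\big)\quad\text{for } r>r_2 .$$ Let $f$ be a transcendental entire function of the form $$f(z)=\prod_{n=1}^{\infty}\Big(1-\frac{z}{a_n}\Big),\qquad 0<|a_1|<|a_2|<\cdots,$$ where $n(r,f)\sim r^{1/2-\varepsilon(r)}$ as $r\to\infty$. Then (a) there exist constants $1<A<B$ and $R>0$ such that $$A\,r^{1/2-\varepsilon(r)}\le \log M(r,f)\le B\,r^{1/2-\varepsilon(r)}\quad\text{for } r>R;$$ (b) there exists $r>0$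 such that $m^n(r)\to\infty$ as $n\to\infty$. -/

import Mathlib

open Filter Topology

noncomputable section

/-- The maximum modulus `M(r, f) = max_{|z| = r} |f z|`, for `r ≥ 0`
(for continuous `f` the supremum over the circle is attained). -/
def maxModulus (f : ℂ → ℂ) (r : ℝ) : ℝ :=
  sSup ((fun z : ℂ => ‖f z‖) '' Metric.sphere (0 : ℂ) r)

/-- The minimum modulus `m(r, f) = min_{|z| = r} |f z|`, for `r ≥ 0`
(for continuous `f` the infimum over the circle is attained). -/
def minModulus (f : ℂ → ℂ) (r : ℝ) : ℝ :=
  sInf ((fun z : ℂ => ‖f z‖) '' Metric.sphere (0 : ℂ) r)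

/-- `n(r, f)`: the number of zeros of `f` in `{z : |z| ≤ r}`, counted according to multiplicity.
For an entire function that is not identically zero the sum has only finitely many
nonzero terms, one for each zero of `f` in the closed disc. -/
def zeroCount (f : ℂ → ℂ) (r : ℝ) : ℕ :=
  ∑ᶠ z ∈ Metric.closedBall (0 : ℂ) r, analyticOrderNatAt f z

/-- A transcendental entire function: entire and not a polynomial. -/
def IsTranscendentalEntire (f : ℂ → ℂ) : Prop :=
  Differentiable ℂ f ∧ ¬ ∃ p : Polynomial ℂ, ∀ z : ℂ, f z = p.eval z

end

open Filter Topology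

noncomputable section

/-! Put φ(r) = r^(1/2 - ε(r)) = √r e^(-k(r)). For large r, φ⁴/r increases and φ²/r decreases. Since
Σ 1/|a_n| converges, finite products bound |f| below up to a factor 1/2 on each disc; hence the a_n
are all the zeros, each simple, and n(r, f) counts them.

(a) Above, log M(r) ≤ Σ log(1 + r/|a_n|), which n(t) ≤ 2φ(t) bounds by Kφ(r)
(`exists_sum_log_one_add_le`). Below, Jensen's inequality gives Σ log(r/|a_n|) over |a_n| ≤ r, up to
log 2; counting at r/4, r/16 and r/64 already yields a constant above 1.

(b) This is a cos πρ argument at the critical order 1/2. Against t^(-3/2) dt, log|1 - t/c| has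
integral zero over (0, ∞), so integrating over [(log r)^(2d), r] leaves only boundary terms
(`sum_truncKernel_le`): at least e^(-k((log r)^(2d))) at the lower end, at most a constant times
e^(-k(r)) at the upper. If m(t) < 2r throughout, the integral is O((log r)^(1-d)). The condition on
k forces k → ∞ and makes the lower term beat both others (`eventually_exp_neg_gt`), a contradiction.
So m exceeds 2r somewhere in that range, while m vanishes at the moduli of zeros; intervals from a
zero to such a point cover one another as r doubles, and compactness gives an escaping orbit
(`exists_tendsto_iterate_atTop`). -/

/-- Partial products `∏_{n < N} (1 - z / a n)`. -/
def partialProd (a : ℕ → ℂ) (N : ℕ) (z : ℂ) : ℂ := ∏ n ∈ Finset.range N, (1 - z / a n)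

/-! ### Truncating the product and counting its zeros. -/

lemma one_sub_sum_le_prod_one_sub {ι : Type*} (s : Finset ι) (x : ι → ℝ)
    (h0 : ∀ i ∈ s, 0 ≤ x i) (h1 : ∀ i ∈ s, x i ≤ 1) :
    1 - ∑ i ∈ s, x i ≤ ∏ i ∈ s, (1 - x i) := by
  classical
  induction s using Finset.induction_on with
  | empty => simp
  | insert i s hi ih =>
    rw [Finset.sum_insert hi, Finset.prod_insert hi]
    have h := ih (fun j hj => h0 j (Finset.mem_insert_of_mem hj))
      (fun j hj => h1 j (Finset.mem_insert_of_mem hj))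
    have hs : 0 ≤ ∑ j ∈ s, x j :=
      Finset.sum_nonneg fun j hj => h0 j (Finset.mem_insert_of_mem hj)
    have hi0 := h0 i (Finset.mem_insert_self i s)
    have hi1 := h1 i (Finset.mem_insert_self i s)
    nlinarith [mul_le_mul_of_nonneg_left h (sub_nonneg.2 hi1), mul_nonneg hi0 hs]

/-- Once the tail of Σ ρ/|a_n| is below 1/2, the tail product has modulus at least 1/2 by
`one_sub_sum_le_prod_one_sub`, uniformly on the disc. -/
lemma half_norm_partialProd_le {a : ℕ → ℂ} {f : ℂ → ℂ}
    (hf_prod : ∀ z : ℂ,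
      Tendsto (fun N : ℕ => ∏ n ∈ Finset.range N, (1 - z / a n)) atTop (𝓝 (f z)))
    (hsum : Summable fun n => 1 / ‖a n‖) (ρ : ℝ) (hρ : 0 ≤ ρ) :
    ∃ N₀ : ℕ, ∀ N ≥ N₀, ∀ z : ℂ, ‖z‖ ≤ ρ → 1 / 2 * ‖partialProd a N z‖ ≤ ‖f z‖ := by
  have hsum' : Summable fun n => ρ / ‖a n‖ := by
    simpa [div_eq_mul_inv] using hsum.mul_left ρ
  have htail := (tendsto_sum_nat_add fun n => ρ / ‖a n‖).eventually_lt_const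
    (u := 1 / 2) (by norm_num)
  obtain ⟨N₀, hN₀⟩ := eventually_atTop.1 htail
  refine ⟨N₀, fun N hN z hz => ?_⟩
  have hlim := ((tendsto_add_atTop_iff_nat N).2 (hf_prod z)).norm
  refine ge_of_tendsto' hlim fun M => ?_
  have hsN : Summable fun n => ρ / ‖a (n + N)‖ :=
    (summable_nat_add_iff (f := fun n => ρ / ‖a n‖) N).2 hsum'
  have hnn : ∀ n, 0 ≤ ρ / ‖a (n + N)‖ := fun n => by positivity
  have hfin : ∑ i ∈ Finset.range M, ρ / ‖a (i + N)‖ < 1 / 2 :=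
    (hsN.sum_le_tsum _ fun i _ => hnn i).trans_lt (hN₀ N hN)
  have hle1 : ∀ i ∈ Finset.range M, ρ / ‖a (i + N)‖ ≤ 1 := fun i hi =>
    ((Finset.single_le_sum (f := fun i => ρ / ‖a (i + N)‖) (fun j _ => hnn j) hi).trans
      hfin.le).trans (by norm_num)
  have hprod := one_sub_sum_le_prod_one_sub (Finset.range M) (fun i => ρ / ‖a (i + N)‖)
    (fun i _ => hnn i) hle1
  have hprod2 : ∏ i ∈ Finset.range M, (1 - ρ / ‖a (i + N)‖) ≤
      ∏ i ∈ Finset.range M, ‖1 - z / a (N + i)‖ := by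
    refine Finset.prod_le_prod (fun i hi => sub_nonneg.2 (hle1 i hi)) fun i hi => ?_
    have h1 : ‖(1 : ℂ)‖ - ‖z / a (N + i)‖ ≤ ‖1 - z / a (N + i)‖ := norm_sub_norm_le _ _
    rw [norm_one, norm_div] at h1
    rw [add_comm i N]
    have : ‖z‖ / ‖a (N + i)‖ ≤ ρ / ‖a (N + i)‖ := by gcongr
    linarith
  rw [add_comm M N, Finset.prod_range_add, norm_mul, mul_comm]
  have h3 : (1 : ℝ) / 2 ≤ ‖∏ x ∈ Finset.range M, (1 - z / a (N + x))‖ := by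
    rw [norm_prod]; linarith
  exact mul_le_mul_of_nonneg_left h3 (norm_nonneg _)

lemma finite_zeros_closedBall {f : ℂ → ℂ} (hf : Differentiable ℂ f) {z₀ : ℂ} (hz₀ : f z₀ ≠ 0)
    (r : ℝ) : (Metric.closedBall (0 : ℂ) r ∩ f ⁻¹' {0}).Finite := by
  have hcod := AnalyticOnNhd.preimage_zero_mem_codiscrete (f := f)
    (fun z _ => hf.analyticAt z) hz₀
  have hd := (mem_codiscrete'.1 hcod).2
  refine IsCompact.finite ?_ (hd.mono ?_)
  · exact (isCompact_closedBall (0 : ℂ) r).inter_right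
      (isClosed_singleton.preimage hf.continuous)
  · intro z hz; simpa using hz.2

lemma analyticOrderNatAt_pos {f : ℂ → ℂ} (hf : Differentiable ℂ f) {z₀ : ℂ} (hz₀ : f z₀ ≠ 0)
    {z : ℂ} (hz : f z = 0) : 1 ≤ analyticOrderNatAt f z := by
  have h1 : analyticOrderAt f z ≠ ⊤ := by
    intro h
    have := (AnalyticOnNhd.analyticOrderAt_eq_top_iff_eq_zero (f := f) z
      (fun z => hf.analyticAt z)).1 h
    exact hz₀ (by rw [this]; rfl)
  have h2 : analyticOrderAt f z ≠ 0 := analyticOrderAt_ne_zero.2 ⟨hf.analyticAt z, hz⟩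
  rw [Nat.one_le_iff_ne_zero]
  intro h
  rw [← Nat.cast_analyticOrderNatAt h1, h] at h2
  simp at h2

lemma support_order_subset {f : ℂ → ℂ} (r : ℝ) :
    (Metric.closedBall (0 : ℂ) r ∩ Function.support (analyticOrderNatAt f)) ⊆
      Metric.closedBall (0 : ℂ) r ∩ f ⁻¹' {0} := fun _ hz =>
  ⟨hz.1, apply_eq_zero_of_analyticOrderNatAt_ne_zero hz.2⟩

lemma zeroCount_eq_sum {f : ℂ → ℂ} (hf : Differentiable ℂ f) {z₀ : ℂ} (hz₀ : f z₀ ≠ 0)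
    (r : ℝ) : zeroCount f r =
      ∑ z ∈ (finite_zeros_closedBall hf hz₀ r).toFinset, analyticOrderNatAt f z := by
  unfold zeroCount
  rw [finsum_mem_eq_sum_of_inter_support_eq]
  ext z
  simp only [Set.mem_inter_iff, Finset.mem_coe, Set.Finite.mem_toFinset]
  constructor
  · rintro ⟨h1, h2⟩
    exact ⟨support_order_subset r ⟨h1, h2⟩, h2⟩
  · rintro ⟨h1, h2⟩
    exact ⟨h1.1, h2⟩

lemma card_le_zeroCount {f : ℂ → ℂ} (hf : Differentiable ℂ f) {z₀ : ℂ} (hz₀ : f z₀ ≠ 0)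
    (r : ℝ) (s : Finset ℂ) (hs : ∀ z ∈ s, ‖z‖ ≤ r ∧ f z = 0) : s.card ≤ zeroCount f r := by
  rw [zeroCount_eq_sum hf hz₀, Finset.card_eq_sum_ones]
  have hsub : s ⊆ (finite_zeros_closedBall hf hz₀ r).toFinset := fun z hz => by
    simpa using hs z hz
  refine (Finset.sum_le_sum fun z hz => analyticOrderNatAt_pos hf hz₀ (hs z hz).2).trans ?_
  exact Finset.sum_le_sum_of_subset hsub

section product
variable {a : ℕ → ℂ} {f : ℂ → ℂ}

lemma norm_pos_of_strictMono (ha_pos : 0 < ‖a 0‖) (ha_mono : StrictMono fun n : ℕ => ‖a n‖)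
    (n : ℕ) : 0 < ‖a n‖ := ha_pos.trans_le (ha_mono.monotone (Nat.zero_le n))

lemma partialProd_apply_zero_of_lt {n N : ℕ} (hn : a n ≠ 0) (hN : n < N) :
    partialProd a N (a n) = 0 :=
  Finset.prod_eq_zero (Finset.mem_range.2 hN) (by rw [div_self hn, sub_self])

lemma eval_zero_of_tendsto_prod
    (hf_prod : ∀ z : ℂ,
      Tendsto (fun N : ℕ => ∏ n ∈ Finset.range N, (1 - z / a n)) atTop (𝓝 (f z))) : f 0 = 1 :=
  tendsto_nhds_unique (hf_prod 0) (by simp)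

lemma eval_root_of_tendsto_prod
    (hf_prod : ∀ z : ℂ,
      Tendsto (fun N : ℕ => ∏ n ∈ Finset.range N, (1 - z / a n)) atTop (𝓝 (f z)))
    {n : ℕ} (hn : a n ≠ 0) : f (a n) = 0 :=
  tendsto_nhds_unique (hf_prod (a n)) <| tendsto_const_nhds.congr' <| by
    filter_upwards [eventually_gt_atTop n] with N hN
    exact (partialProd_apply_zero_of_lt hn hN).symm

lemma lt_zeroCount_of_le (hf : Differentiable ℂ f)
    (ha_pos : 0 < ‖a 0‖) (ha_mono : StrictMono fun n : ℕ => ‖a n‖)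
    (hf_prod : ∀ z : ℂ,
      Tendsto (fun N : ℕ => ∏ n ∈ Finset.range N, (1 - z / a n)) atTop (𝓝 (f z)))
    {n : ℕ} {t : ℝ} (h : ‖a n‖ ≤ t) : n < zeroCount f t := by
  classical
  have hinj : Function.Injective a := fun i j hij => ha_mono.injective (by simp [hij])
  have := card_le_zeroCount hf (z₀ := 0) (by rw [eval_zero_of_tendsto_prod hf_prod]; simp) t
    ((Finset.range (n + 1)).image a) (by
      intro z hz
      obtain ⟨i, hi, rfl⟩ := Finset.mem_image.1 hz
      refine ⟨(ha_mono.monotone (Nat.lt_succ_iff.1 (Finset.mem_range.1 hi))).trans h, ?_⟩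
      exact eval_root_of_tendsto_prod hf_prod
        (norm_pos_iff.1 (norm_pos_of_strictMono ha_pos ha_mono i)))
  rwa [Finset.card_image_of_injective _ hinj, Finset.card_range] at this

lemma tendsto_norm_roots (hf : Differentiable ℂ f)
    (ha_pos : 0 < ‖a 0‖) (ha_mono : StrictMono fun n : ℕ => ‖a n‖)
    (hf_prod : ∀ z : ℂ,
      Tendsto (fun N : ℕ => ∏ n ∈ Finset.range N, (1 - z / a n)) atTop (𝓝 (f z))) :
    Tendsto (fun n => ‖a n‖) atTop atTop := by
  refine tendsto_atTop_atTop_of_monotone ha_mono.monotone fun t => ?_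
  refine ⟨zeroCount f t, ?_⟩
  by_contra! h
  exact lt_irrefl _ (lt_zeroCount_of_le hf ha_pos ha_mono hf_prod h.le)

/-- Evaluating the count at t = |a_n| gives n + 1 ≤ 2√|a_n|, so the terms are at most 4/(n + 1)². -/
lemma summable_inv_norm_roots (hf : Differentiable ℂ f)
    (ha_pos : 0 < ‖a 0‖) (ha_mono : StrictMono fun n : ℕ => ‖a n‖)
    (hf_prod : ∀ z : ℂ,
      Tendsto (fun N : ℕ => ∏ n ∈ Finset.range N, (1 - z / a n)) atTop (𝓝 (f z)))
    (hcount : ∀ᶠ t : ℝ in atTop, (zeroCount f t : ℝ) ≤ 2 * √t) :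
    Summable fun n => 1 / ‖a n‖ := by
  have h2 : Summable fun n : ℕ => 4 * (1 / ((n : ℝ) + 1) ^ 2) := by
    refine Summable.mul_left _ ?_
    have := (summable_nat_add_iff 1).2 (Real.summable_one_div_nat_pow.2 (le_refl 2))
    simpa using this
  refine Summable.of_norm_bounded_eventually_nat h2 ?_
  filter_upwards [(tendsto_norm_roots hf ha_pos ha_mono hf_prod).eventually hcount] with n hn
  have hp := norm_pos_of_strictMono ha_pos ha_mono n
  have h1 : ((n : ℝ) + 1) ≤ zeroCount f ‖a n‖ := by
    exact_mod_cast lt_zeroCount_of_le hf ha_pos ha_mono hf_prod (le_refl ‖a n‖)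
  have h3 : ((n : ℝ) + 1) ^ 2 ≤ 4 * ‖a n‖ := by
    calc ((n : ℝ) + 1) ^ 2 ≤ (2 * √‖a n‖) ^ 2 := by gcongr; exact h1.trans hn
      _ = 4 * ‖a n‖ := by rw [mul_pow, Real.sq_sqrt hp.le]; norm_num
  rw [Real.norm_of_nonneg (by positivity), mul_one_div, div_le_div_iff₀ hp (by positivity)]
  linarith

lemma partialProd_ne_zero {z : ℂ} (hz : ∀ n, z ≠ a n) (ha : ∀ n, a n ≠ 0) (N : ℕ) :
    partialProd a N z ≠ 0 :=
  Finset.prod_ne_zero_iff.2 fun n _ h => hz n (by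
    rw [sub_eq_zero, eq_comm, div_eq_one_iff_eq (ha n)] at h; exact h)

lemma deriv_ne_zero_of_norm_sub_le {f q : ℂ → ℂ} {z₀ : ℂ} (hf : DifferentiableAt ℂ f z₀)
    (hz₀ : f z₀ = 0) (hq : ContinuousAt q z₀) (hq0 : q z₀ ≠ 0)
    (h : ∀ᶠ z in 𝓝 z₀, ‖z - z₀‖ * ‖q z‖ ≤ ‖f z‖) : deriv f z₀ ≠ 0 := by
  have h1 := (hasDerivAt_iff_tendsto_slope.1 hf.hasDerivAt).norm
  have h2 : Tendsto (fun z => ‖q z‖) (𝓝[≠] z₀) (𝓝 ‖q z₀‖) :=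
    (hq.norm.tendsto).mono_left nhdsWithin_le_nhds
  have h3 : ‖q z₀‖ ≤ ‖deriv f z₀‖ := by
    refine le_of_tendsto_of_tendsto h2 h1 ?_
    filter_upwards [h.filter_mono nhdsWithin_le_nhds, self_mem_nhdsWithin] with z hz hne
    have hpos : 0 < ‖z - z₀‖ := norm_pos_iff.2 (sub_ne_zero.2 hne)
    rw [slope_def_field, hz₀, sub_zero, norm_div, le_div_iff₀ hpos, mul_comm]
    exact hz
  exact norm_pos_iff.1 ((norm_pos_iff.2 hq0).trans_le h3)

lemma analyticOrderNatAt_root (hf : Differentiable ℂ f)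
    (ha_pos : 0 < ‖a 0‖) (ha_mono : StrictMono fun n : ℕ => ‖a n‖)
    (hf_prod : ∀ z : ℂ,
      Tendsto (fun N : ℕ => ∏ n ∈ Finset.range N, (1 - z / a n)) atTop (𝓝 (f z)))
    (hsum : Summable fun n => 1 / ‖a n‖) (n : ℕ) : analyticOrderNatAt f (a n) = 1 := by
  have hne : ∀ m, a m ≠ 0 := fun m => norm_pos_iff.1 (norm_pos_of_strictMono ha_pos ha_mono m)
  have hroot := eval_root_of_tendsto_prod hf_prod (hne n)
  obtain ⟨N₀, hN₀⟩ := half_norm_partialProd_le hf_prod hsum (‖a n‖ + 1) (by positivity)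
  set N := max N₀ (n + 1)
  have hnN : n ∈ Finset.range N := Finset.mem_range.2 (by omega)
  have hd : deriv f (a n) ≠ 0 := by
    -- Removing the factor of a_n from the truncated product leaves q nonzero at a_n, so f vanishes
    -- there only to first order.
    refine deriv_ne_zero_of_norm_sub_le
      (q := fun z => (1 / 2) * (a n)⁻¹ * ∏ m ∈ (Finset.range N).erase n, (1 - z / a m))
      hf.differentiableAt hroot (by fun_prop) ?_ ?_
    · refine mul_ne_zero (mul_ne_zero (by norm_num) (inv_ne_zero (hne n))) ?_
      refine Finset.prod_ne_zero_iff.2 fun m hm h => ?_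
      rw [sub_eq_zero, eq_comm, div_eq_one_iff_eq (hne m)] at h
      exact (Finset.mem_erase.1 hm).1 (ha_mono.injective (by simp [h]))
    · filter_upwards [Metric.ball_mem_nhds (a n) one_pos] with z hz
      have hz1 : ‖z‖ ≤ ‖a n‖ + 1 := by
        have := norm_sub_norm_le z (a n)
        rw [Metric.mem_ball, dist_eq_norm] at hz
        linarith
      refine le_trans (le_of_eq ?_) (hN₀ N (le_max_left _ _) z hz1)
      rw [partialProd, ← Finset.mul_prod_erase _ _ hnN, norm_mul, norm_mul, norm_mul]
      have : ‖1 - z / a n‖ = ‖z - a n‖ * ‖(a n)⁻¹‖ := by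
        rw [← norm_mul, ← norm_neg]
        congr 1
        field_simp [hne n]
        ring
      rw [this]
      norm_num
      ring
  have := (hf.analyticAt (a n)).analyticOrderAt_eq_one_of_zero_deriv_ne_zero hroot hd
  simp [analyticOrderNatAt, this]

theorem norm_root_le_iff_lt_zeroCount (hf : Differentiable ℂ f)
    (ha_pos : 0 < ‖a 0‖) (ha_mono : StrictMono fun n : ℕ => ‖a n‖)
    (hf_prod : ∀ z : ℂ,
      Tendsto (fun N : ℕ => ∏ n ∈ Finset.range N, (1 - z / a n)) atTop (𝓝 (f z)))
    (hsum : Summable fun n => 1 / ‖a n‖) (n : ℕ) (t : ℝ) :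
    ‖a n‖ ≤ t ↔ n < zeroCount f t := by
  classical
  refine ⟨lt_zeroCount_of_le hf ha_pos ha_mono hf_prod, fun h => ?_⟩
  by_contra! hlt
  have hne : ∀ m, a m ≠ 0 := fun m => norm_pos_iff.1 (norm_pos_of_strictMono ha_pos ha_mono m)
  have hz₀ : f 0 ≠ 0 := by rw [eval_zero_of_tendsto_prod hf_prod]; simp
  -- A zero of f is a zero of some partial product, because the tail factor is at least 1/2.
  have hex : ∀ z, f z = 0 → ∃ m, a m = z := by
    intro z hz
    by_contra! hza
    obtain ⟨N₀, hN₀⟩ := half_norm_partialProd_le hf_prod hsum ‖z‖ (norm_nonneg z)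
    have h1 := hN₀ N₀ le_rfl z le_rfl
    have h2 := norm_pos_iff.2 (partialProd_ne_zero (fun m => (hza m).symm) hne N₀)
    rw [hz, norm_zero] at h1
    linarith
  have hsub : (finite_zeros_closedBall hf hz₀ t).toFinset ⊆ (Finset.range n).image a := by
    intro z hz
    simp only [Set.Finite.mem_toFinset, Set.mem_inter_iff, mem_closedBall_zero_iff,
      Set.mem_preimage, Set.mem_singleton_iff] at hz
    obtain ⟨m, rfl⟩ := hex z hz.2
    exact Finset.mem_image.2 ⟨m, Finset.mem_range.2
      (ha_mono.lt_iff_lt.1 (hz.1.trans_lt hlt)), rfl⟩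
  have : zeroCount f t ≤ n := by
    rw [zeroCount_eq_sum hf hz₀]
    refine (Finset.sum_le_sum_of_subset hsub).trans ?_
    have hone : ∀ z ∈ (Finset.range n).image a, analyticOrderNatAt f z ≤ 1 := by
      intro z hz
      obtain ⟨m, _, rfl⟩ := Finset.mem_image.1 hz
      exact (analyticOrderNatAt_root hf ha_pos ha_mono hf_prod hsum m).le
    refine (Finset.sum_le_card_nsmul _ _ 1 hone).trans ?_
    simpa using Finset.card_image_le (s := Finset.range n) (f := a)
  omega

end product

/-! ### Upper bound for Σ log(1 + r/c_n) by telescoping. -/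

lemma log_one_add_pow_four_le {y : ℝ} (hy : 1 ≤ y) : Real.log (1 + y ^ 4) ≤ 8 * √y := by
  have hy0 : 0 < y := by linarith
  have h1 : 1 + y ^ 4 ≤ 2 * y ^ 4 := by nlinarith [one_le_pow₀ hy (n := 4)]
  have h2 : Real.log (1 + y ^ 4) ≤ Real.log 2 + 4 * Real.log y := by
    calc Real.log (1 + y ^ 4) ≤ Real.log (2 * y ^ 4) := Real.log_le_log (by positivity) h1
      _ = _ := by rw [Real.log_mul (by norm_num) (by positivity), Real.log_pow]; norm_num
  have h3 : Real.log (√y) ≤ √y - 1 := Real.log_le_sub_one_of_pos (Real.sqrt_pos.2 hy0)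
  rw [Real.log_sqrt hy0.le] at h3
  have := Real.log_two_lt_d9
  linarith

/-- A concave bounded function whose increments dominate the terms of a dyadic tail estimate. -/
def telescope (X u : ℝ) : ℝ := X * (√u / (√u + √X))

lemma telescope_increment_ge {X m : ℝ} (hX : 0 < X) (hm : 1 ≤ m) :
    √X ^ 3 / (2 * √m * (√m + √X) ^ 2) ≤ telescope X m - telescope X (m - 1) := by
  have hq : 0 < √X := Real.sqrt_pos.2 hX
  have hp : 0 < √m := Real.sqrt_pos.2 (by linarith)
  have hp0 : 0 ≤ √(m - 1) := Real.sqrt_nonneg _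
  have h1 : √m ^ 2 = m := Real.sq_sqrt (by linarith)
  have h2 : √(m - 1) ^ 2 = m - 1 := Real.sq_sqrt (by linarith)
  have hX2 : √X ^ 2 = X := Real.sq_sqrt hX.le
  have hle : √(m - 1) ≤ √m := Real.sqrt_le_sqrt (by linarith)
  unfold telescope
  set p := √m
  set q := √X
  set p0 := √(m - 1)
  have hdiff : X * (p / (p + q)) - X * (p0 / (p0 + q)) =
      q ^ 3 / ((p + p0) * ((p + q) * (p0 + q))) := by
    rw [← hX2]
    have : (p - p0) * (p + p0) = 1 := by linarith [show (p-p0)*(p+p0) = p^2-p0^2 by ring]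
    have hpp : 0 < p + p0 := by linarith
    field_simp
    linear_combination (q) * this
  rw [hdiff]
  gcongr
  · linarith
  · rw [sq]; gcongr

/-- The increment is at least √(X/m)/8 when m ≤ X and (X/m)^(3/2)/8 when m > X. The logarithm is at
most 8√(X/m) in the first range and (X/m)² in the second, whence 64 = 8 · 8. -/
lemma log_one_add_le_telescope {X m x : ℝ} (hX : 0 < X) (hm : 1 ≤ m) (hx : 0 ≤ x)
    (h4 : 1 ≤ X / m → x ≤ (X / m) ^ 4) (h2 : X / m < 1 → x ≤ (X / m) ^ 2) :
    Real.log (1 + x) ≤ 64 * (telescope X m - telescope X (m - 1)) := by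
  have hinc := telescope_increment_ge hX hm
  have hm0 : 0 < m := by linarith
  have hq : 0 < √X := Real.sqrt_pos.2 hX
  have hp : 0 < √m := Real.sqrt_pos.2 hm0
  rcases le_or_gt 1 (X / m) with h | h
  · have h1 : Real.log (1 + x) ≤ 8 * √(X / m) :=
      (Real.log_le_log (by linarith) (by linarith [h4 h])).trans (log_one_add_pow_four_le h)
    rw [Real.sqrt_div hX.le] at h1
    have hmX : √m ≤ √X := Real.sqrt_le_sqrt (by rwa [one_le_div hm0] at h)
    have h3 : √X / √m ≤ 8 * (√X ^ 3 / (2 * √m * (√m + √X) ^ 2)) := by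
      calc √X / √m = 8 * (√X ^ 3 / (2 * √m * (√X + √X) ^ 2)) := by field_simp; ring
        _ ≤ _ := by gcongr
    linarith
  · have h1 : Real.log (1 + x) ≤ (X / m) ^ 2 := by
      have := Real.log_le_sub_one_of_pos (show 0 < 1 + x by linarith)
      linarith [h2 h]
    have hmX : √X ≤ √m := Real.sqrt_le_sqrt (by rw [div_lt_one hm0] at h; exact h.le)
    have h3 : (X / m) ^ 2 ≤ 8 * (√X ^ 3 / (2 * √m * (√m + √X) ^ 2)) := by
      calc (X / m) ^ 2 = √X ^ 3 * √X / (√m ^ 3 * √m) := by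
            nth_rewrite 1 [← Real.sq_sqrt hX.le, ← Real.sq_sqrt hm0.le]
            field_simp
        _ ≤ √X ^ 3 * √m / (√m ^ 3 * √m) := by gcongr
        _ = 8 * (√X ^ 3 / (2 * √m * (√m + √m) ^ 2)) := by field_simp; ring
        _ ≤ _ := by gcongr
    have : 0 ≤ (X / m) ^ 2 := by positivity
    linarith

lemma sum_telescope_le {X : ℝ} (hX : 0 < X) (M : ℕ) :
    ∑ n ∈ Finset.range M, (telescope X (n + 1) - telescope X ((n + 1 : ℝ) - 1)) ≤ X := by
  have h : ∑ n ∈ Finset.range M, (telescope X (n + 1) - telescope X ((n + 1 : ℝ) - 1)) =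
      telescope X M := by
    have := Finset.sum_range_sub (fun n : ℕ => telescope X n) M
    simp only [Nat.cast_add, Nat.cast_one, Nat.cast_zero] at this
    simp only [add_sub_cancel_right]
    rw [this]
    simp [telescope]
  rw [h, telescope]
  have hq : 0 < √X := Real.sqrt_pos.2 hX
  have : √(M : ℝ) / (√(M : ℝ) + √X) ≤ 1 := by
    rw [div_le_one (by positivity)]; linarith
  nlinarith

/-- If the counting function `N` of `b` is at most `2 φ`, where `φ ^ 4 / r` increases and
`φ ^ 2 / r` decreases, then `∑ log (1 + r / b n) = O(φ r)`. -/
theorem exists_sum_log_one_add_le {φ : ℝ → ℝ} {c : ℕ → ℝ} {N : ℝ → ℕ} {r₀ : ℝ}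
    (hc : ∀ n, 0 < c n) (hmono : Monotone c) (hN : ∀ n t, c n ≤ t ↔ n < N t) (hr₀ : 0 < r₀)
    (hφ_four : ∀ t r, r₀ < t → t ≤ r → φ t ^ 4 * r ≤ t * φ r ^ 4)
    (hφ_two : ∀ r t, r₀ < r → r ≤ t → φ t ^ 2 * r ≤ t * φ r ^ 2)
    (hφ : ∀ r, r₀ < r → 0 < φ r ∧ r ≤ φ r ^ 4)
    (hle : ∀ᶠ t in atTop, (N t : ℝ) ≤ 2 * φ t) :
    ∃ K R : ℝ, 0 < K ∧ ∀ r, R < r → ∀ M : ℕ,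
      ∑ n ∈ Finset.range M, Real.log (1 + r / c n) ≤ K * φ r := by
  obtain ⟨t₀, ht₀⟩ := eventually_atTop.1 hle
  set t₁ := max t₀ r₀
  -- The 2 comes from the count bound; the other term absorbs the finitely many c_n ≤ t₁, where that
  -- bound is unavailable.
  set K₁ : ℝ := 2 + N t₁ * (1 + 1 / c 0)
  have hc0 := hc 0
  have hK₁ : 2 ≤ K₁ := le_add_of_nonneg_right (by positivity)
  have hK₁4 : (N t₁ : ℝ) ^ 4 ≤ K₁ ^ 4 * c 0 := by
    have h1 : (N t₁ : ℝ) * (1 + 1 / c 0) ≤ K₁ := le_add_of_nonneg_left (by norm_num)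
    have h2 : 1 ≤ (1 + 1 / c 0) ^ 4 * c 0 := by
      have h3 := one_add_mul_le_pow (a := 1 / c 0) (by have : 0 < 1 / c 0 := by positivity
                                                       linarith) 4
      have h4 : 1 / c 0 ≤ (1 + 1 / c 0) ^ 4 := by
        have : 0 < 1 / c 0 := by positivity
        push_cast at h3
        linarith
      rwa [div_le_iff₀ hc0] at h4
    calc (N t₁ : ℝ) ^ 4 ≤ (N t₁ : ℝ) ^ 4 * ((1 + 1 / c 0) ^ 4 * c 0) :=
          le_mul_of_one_le_right (by positivity) h2
      _ = (N t₁ * (1 + 1 / c 0)) ^ 4 * c 0 := by ring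
      _ ≤ K₁ ^ 4 * c 0 := by gcongr
  refine ⟨64 * K₁, t₁, by positivity, fun r hr M => ?_⟩
  have hr0 : r₀ < r := (le_max_right _ _).trans_lt hr
  have hrpos : 0 < r := hr₀.trans hr0
  obtain ⟨hφr, hφr4⟩ := hφ r hr0
  have hX : 0 < K₁ * φ r := by positivity
  have hterm : ∀ n : ℕ, Real.log (1 + r / c n) ≤ 64 * (telescope (K₁ * φ r) (n + 1) -
      telescope (K₁ * φ r) ((n + 1 : ℝ) - 1)) := by
    intro n
    have hcn := hc n
    have hm : (0 : ℝ) < n + 1 := by positivity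
    have hbig : t₁ < c n → ((n : ℝ) + 1) ≤ 2 * φ (c n) := fun h => by
      have h1 : ((n : ℝ) + 1) ≤ N (c n) := by exact_mod_cast (hN n (c n)).1 le_rfl
      exact h1.trans (ht₀ _ ((le_max_left _ _).trans h.le))
    have hfar : r < c n → r / c n ≤ (K₁ * φ r / (n + 1)) ^ 2 := fun h => by
      have h1 := hbig (hr.trans h)
      rw [div_pow, div_le_div_iff₀ hcn (by positivity)]
      calc r * ((n : ℝ) + 1) ^ 2 ≤ r * (2 * φ (c n)) ^ 2 := by gcongr
        _ = 2 ^ 2 * (φ (c n) ^ 2 * r) := by ring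
        _ ≤ 2 ^ 2 * (c n * φ r ^ 2) :=
          mul_le_mul_of_nonneg_left (hφ_two r (c n) hr0 h.le) (by norm_num)
        _ ≤ K₁ ^ 2 * (c n * φ r ^ 2) := by gcongr
        _ = _ := by ring
    have hnear : c n ≤ r → r / c n ≤ (K₁ * φ r / (n + 1)) ^ 4 := fun h => by
      rw [div_pow, div_le_div_iff₀ hcn (by positivity)]
      rcases le_or_gt (c n) t₁ with h1 | h1
      · have h2 : ((n : ℝ) + 1) ≤ N t₁ := by exact_mod_cast (hN n t₁).1 h1
        calc r * ((n : ℝ) + 1) ^ 4 ≤ φ r ^ 4 * (N t₁ : ℝ) ^ 4 := by gcongr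
          _ ≤ φ r ^ 4 * (K₁ ^ 4 * c n) := by
            gcongr; exact hK₁4.trans (by gcongr; exact hmono (Nat.zero_le n))
          _ = _ := by ring
      · have h2 := hbig h1
        calc r * ((n : ℝ) + 1) ^ 4 ≤ r * (2 * φ (c n)) ^ 4 := by gcongr
          _ = 2 ^ 4 * (φ (c n) ^ 4 * r) := by ring
          _ ≤ 2 ^ 4 * (c n * φ r ^ 4) := by
            exact mul_le_mul_of_nonneg_left
              (hφ_four (c n) r ((le_max_right _ _).trans_lt h1) h) (by norm_num)
          _ ≤ K₁ ^ 4 * (c n * φ r ^ 4) := by gcongr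
          _ = _ := by ring
    have hy : 0 < K₁ * φ r / ((n : ℝ) + 1) := by positivity
    refine log_one_add_le_telescope hX (by linarith [n.cast_nonneg (α := ℝ)]) (by positivity)
      (fun h1 => ?_) (fun h1 => ?_)
    · rcases le_or_gt (c n) r with h | h
      · exact hnear h
      · exact (hfar h).trans (pow_le_pow_right₀ h1 (by norm_num))
    · rcases le_or_gt (c n) r with h | h
      -- This case is void: 1 ≤ r/c_n ≤ (X/m)⁴ < 1.
      · have h2 := (one_le_div hcn).2 h
        exact absurd (h2.trans (hnear h)) (not_le.2 (pow_lt_one₀ hy.le h1 (by norm_num)))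
      · exact hfar h
  calc ∑ n ∈ Finset.range M, Real.log (1 + r / c n)
      ≤ ∑ n ∈ Finset.range M, 64 * (telescope (K₁ * φ r) (n + 1) -
        telescope (K₁ * φ r) ((n + 1 : ℝ) - 1)) := Finset.sum_le_sum fun n _ => hterm n
    _ ≤ 64 * (K₁ * φ r) := by
      rw [← Finset.mul_sum]; gcongr; exact sum_telescope_le hX M
    _ = _ := by ring

/-! ### The boundary kernel of the weighted logarithmic integral. -/

/-- `2 ((1 + v) log (1 + v) + (1 - v) log |1 - v|)`; `-s⁻¹ * truncKernel (s / β)` is a primitive of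
`2 s⁻² log |1 - (s / β) ^ 2|`. -/
def truncKernel (v : ℝ) : ℝ :=
  2 * ((1 + v) * Real.log (1 + v) + (1 - v) * Real.log (1 - v))

lemma continuous_truncKernel : Continuous truncKernel := by
  unfold truncKernel
  exact continuous_const.mul
    ((Real.continuous_mul_log.comp (continuous_const.add continuous_id)).add
      (Real.continuous_mul_log.comp (continuous_const.sub continuous_id)))

lemma truncKernel_nonneg_of_le_one {v : ℝ} (hv : 0 ≤ v) (hv1 : v ≤ 1) : 0 ≤ truncKernel v := by
  have h : ∀ x : ℝ, 0 ≤ x → x - 1 ≤ x * Real.log x := fun x hx => by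
    rcases hx.eq_or_lt with rfl | hx
    · simp
    · have h1 := Real.one_sub_inv_le_log_of_pos hx
      have := mul_le_mul_of_nonneg_left h1 hx.le
      rwa [mul_sub, mul_one, mul_inv_cancel₀ hx.ne'] at this
  unfold truncKernel
  have h1 := h (1 + v) (by linarith)
  have h2 := h (1 - v) (by linarith)
  linarith

lemma log_one_sub_eq (v : ℝ) : Real.log (1 - v) = Real.log (v - 1) := by
  rw [← Real.log_neg_eq_log, neg_sub]

/-- `Real.log` ignores sign, so for v ≥ 1 the kernel is 2((1 + v) log(1 + v) - (v - 1) log(v - 1)) ≥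
4 log(1 + v). -/
lemma four_mul_log_two_le_truncKernel {v : ℝ} (hv : 1 ≤ v) : 4 * Real.log 2 ≤ truncKernel v := by
  unfold truncKernel
  rw [log_one_sub_eq]
  have h1 : (v - 1) * Real.log (v - 1) ≤ (v - 1) * Real.log (1 + v) := by
    rcases hv.eq_or_lt with rfl | hv
    · simp
    · exact mul_le_mul_of_nonneg_left (Real.log_le_log (by linarith) (by linarith)) (by linarith)
  have h2 : Real.log 2 ≤ Real.log (1 + v) := Real.log_le_log (by norm_num) (by linarith)
  linarith

lemma truncKernel_nonneg {v : ℝ} (hv : 0 ≤ v) : 0 ≤ truncKernel v := by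
  rcases le_total v 1 with h | h
  · exact truncKernel_nonneg_of_le_one hv h
  · have := four_mul_log_two_le_truncKernel h
    have := Real.log_pos one_lt_two
    linarith

/-- The kernel is at most 4v² on [0, 1] and at most 4 log(1 + v) + 4 beyond. The comparison with
log(1 + v²) brings the upper boundary term under the sum that also bounds log M. -/
lemma truncKernel_le {v : ℝ} (hv : 0 ≤ v) : truncKernel v ≤ 16 * Real.log (1 + v ^ 2) := by
  have hl : ∀ x : ℝ, 0 < x → Real.log x ≤ x - 1 := fun x => Real.log_le_sub_one_of_pos
  unfold truncKernel
  rcases le_or_gt v 1 with h | h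
  · have h1 : (1 + v) * Real.log (1 + v) ≤ (1 + v) * v :=
      mul_le_mul_of_nonneg_left (by linarith [hl (1 + v) (by linarith)]) (by linarith)
    have h2 : (1 - v) * Real.log (1 - v) ≤ (1 - v) * (-v) := by
      rcases h.eq_or_lt with rfl | h
      · simp
      · exact mul_le_mul_of_nonneg_left (by linarith [hl (1 - v) (by linarith)]) (by linarith)
    have h3 := Real.one_sub_inv_le_log_of_pos (show 0 < 1 + v ^ 2 by positivity)
    have h4 : v ^ 2 / 2 ≤ 1 - (1 + v ^ 2)⁻¹ := by
      rw [← sub_nonneg]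
      have : 1 - (1 + v ^ 2)⁻¹ - v ^ 2 / 2 = v ^ 2 * (1 - v ^ 2) / (2 * (1 + v ^ 2)) := by
        field_simp; ring
      rw [this]
      have : 0 ≤ 1 - v ^ 2 := by nlinarith
      positivity
    nlinarith
  · rw [log_one_sub_eq]
    have hv1 : 0 < v - 1 := by linarith
    have h1 : (v - 1) * (Real.log (1 + v) - Real.log (v - 1)) ≤ 2 := by
      rw [← Real.log_div (by linarith) hv1.ne']
      have := hl ((1 + v) / (v - 1)) (by positivity)
      have h2 := mul_le_mul_of_nonneg_left this hv1.le
      have h3 : (v - 1) * ((1 + v) / (v - 1) - 1) = 2 := by field_simp; ring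
      linarith
    have h2 : Real.log 2 ≤ Real.log (1 + v ^ 2) :=
      Real.log_le_log (by norm_num) (by nlinarith)
    have h3 : Real.log (1 + v) ≤ Real.log 2 + Real.log (1 + v ^ 2) := by
      rw [← Real.log_mul (by norm_num) (by positivity)]
      exact Real.log_le_log (by linarith) (by nlinarith)
    have := Real.log_two_gt_d9
    linarith

lemma hasDerivAt_truncKernel {v : ℝ} (h1 : 1 + v ≠ 0) (h2 : 1 - v ≠ 0) :
    HasDerivAt truncKernel (2 * (Real.log (1 + v) - Real.log (1 - v))) v := by
  have e1 := (Real.hasDerivAt_mul_log h1).comp v ((hasDerivAt_id v).const_add 1)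
  have e2 := (Real.hasDerivAt_mul_log h2).comp v ((hasDerivAt_id v).const_sub 1)
  exact ((e1.add e2).const_mul 2).congr_deriv (by ring)

lemma hasDerivAt_truncKernel_div {s β : ℝ} (hs : 0 < s) (hβ : 0 < β) (hne : s ≠ β) :
    HasDerivAt (fun s => -(s⁻¹ * truncKernel (s / β)))
      (Real.log ‖1 - (s / β) ^ 2‖ * (2 / s ^ 2)) s := by
  have hv : 1 + s / β ≠ 0 := by positivity
  have hv' : 1 - s / β ≠ 0 := by
    rw [sub_ne_zero, ne_comm, Ne, div_eq_one_iff_eq hβ.ne']; exact hne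
  have e1 := (hasDerivAt_truncKernel hv hv').comp s ((hasDerivAt_id s).div_const β)
  refine (((hasDerivAt_inv hs.ne').mul e1).neg).congr_deriv ?_
  have hlog : Real.log ‖1 - (s / β) ^ 2‖ = Real.log (1 + s / β) + Real.log (1 - s / β) := by
    rw [Real.norm_eq_abs, Real.log_abs, ← Real.log_mul hv hv']
    congr 1; ring
  rw [hlog]
  simp only [truncKernel, Function.comp, id]
  field_simp
  ring

lemma intervalIntegrable_log_norm_one_sub {ρ σ β : ℝ} (hρ : 0 < ρ) (hρσ : ρ ≤ σ) :
    IntervalIntegrable (fun s => Real.log ‖1 - (s / β) ^ 2‖ * (2 / s ^ 2))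
      MeasureTheory.volume ρ σ := by
  refine IntervalIntegrable.mul_continuousOn ?_ ?_
  · refine MeromorphicOn.intervalIntegrable_log_norm (f := fun s : ℝ => 1 - (s / β) ^ 2) ?_
    intro z _
    fun_prop
  · rw [Set.uIcc_of_le hρσ]
    intro s hs
    have : s ≠ 0 := (hρ.trans_le hs.1).ne'
    exact ContinuousAt.continuousWithinAt (by fun_prop (disch := positivity))

lemma integral_log_norm_one_sub {ρ σ β : ℝ} (hρ : 0 < ρ) (hρσ : ρ ≤ σ) (hβ : 0 < β) :
    ∫ s in ρ..σ, Real.log ‖1 - (s / β) ^ 2‖ * (2 / s ^ 2) =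
      ρ⁻¹ * truncKernel (ρ / β) - σ⁻¹ * truncKernel (σ / β) := by
  -- The primitive is continuous across the logarithmic singularity s = β, so that single point may
  -- be excepted.
  rw [MeasureTheory.integral_eq_of_hasDerivAt_off_countable_of_le
    (fun s => -(s⁻¹ * truncKernel (s / β))) _ hρσ (Set.countable_singleton β) ?_ ?_
    (intervalIntegrable_log_norm_one_sub hρ hρσ)]
  · ring
  · have := continuous_truncKernel
    intro s hs
    have : s ≠ 0 := (hρ.trans_le hs.1).ne'
    exact ContinuousAt.continuousWithinAt (by fun_prop (disch := assumption))
  · intro s hs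
    exact hasDerivAt_truncKernel_div (hρ.trans hs.1.1) hβ hs.2

lemma integral_two_div_sq {ρ σ : ℝ} (hρ : 0 < ρ) (hρσ : ρ ≤ σ) :
    ∫ s in ρ..σ, 2 / s ^ 2 = 2 / ρ - 2 / σ := by
  have hne : ∀ s ∈ Set.uIcc ρ σ, s ≠ 0 := by
    rw [Set.uIcc_of_le hρσ]
    exact fun s hs => (hρ.trans_le hs.1).ne'
  rw [intervalIntegral.integral_eq_sub_of_hasDerivAt (f := fun s => -(2 / s))]
  · ring
  · intro s hs
    have := ((hasDerivAt_inv (hne s hs)).const_mul 2).neg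
    convert! this using 1
    field_simp
  · refine ContinuousOn.intervalIntegrable fun s hs => ?_
    have := hne s hs
    exact ContinuousAt.continuousWithinAt (by fun_prop (disch := positivity))

/-- If `∏_{n < N} |1 - t / c n| ≤ e ^ L` for `ρ ^ 2 ≤ t ≤ σ ^ 2`, then integration of the logarithm
against `t ^ (-3 / 2)` bounds the truncated sum at `ρ` by the one at `σ`. -/
theorem sum_truncKernel_le {c : ℕ → ℝ} (hc : ∀ n, 0 < c n) {ρ σ L : ℝ} (hρ : 0 < ρ) (hρσ : ρ ≤ σ)
    (hL : 0 ≤ L) (N : ℕ)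
    (h : ∀ s, ρ ≤ s → s ≤ σ → ∏ n ∈ Finset.range N, ‖1 - s ^ 2 / c n‖ ≤ Real.exp L) :
    ρ⁻¹ * ∑ n ∈ Finset.range N, truncKernel (ρ / √(c n)) ≤
      σ⁻¹ * ∑ n ∈ Finset.range N, truncKernel (σ / √(c n)) + 2 * L / ρ := by
  have hσ : 0 < σ := hρ.trans_le hρσ
  have hβ : ∀ n, 0 < √(c n) := fun n => Real.sqrt_pos.2 (hc n)
  have hint : ∀ n ∈ Finset.range N, IntervalIntegrable
      (fun s => Real.log ‖1 - (s / √(c n)) ^ 2‖ * (2 / s ^ 2)) MeasureTheory.volume ρ σ :=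
    fun n _ => intervalIntegrable_log_norm_one_sub hρ hρσ
  have hsum := intervalIntegral.integral_finsetSum hint
  simp only [integral_log_norm_one_sub hρ hρσ (hβ _), Finset.sum_sub_distrib,
    ← Finset.mul_sum] at hsum
  have hint2 : IntervalIntegrable (fun s : ℝ => L * (2 / s ^ 2)) MeasureTheory.volume ρ σ := by
    refine ContinuousOn.intervalIntegrable ?_
    rw [Set.uIcc_of_le hρσ]
    intro s hs
    have : s ≠ 0 := (hρ.trans_le hs.1).ne'
    exact ContinuousAt.continuousWithinAt (by fun_prop (disch := positivity))
  have hle : ∫ s in ρ..σ, ∑ n ∈ Finset.range N, Real.log ‖1 - (s / √(c n)) ^ 2‖ * (2 / s ^ 2) ≤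
      ∫ s in ρ..σ, L * (2 / s ^ 2) := by
    -- Off the finite set of zeros the logarithm of the product is the sum of the logarithms.
    refine intervalIntegral.integral_mono_ae_restrict hρσ
      (by simpa [Finset.sum_fn] using! IntervalIntegrable.sum _ hint) hint2 ?_
    have hfin : (Set.range fun n : ℕ => √(c n)).Countable := Set.countable_range _
    have hae : ∀ᵐ s ∂(MeasureTheory.volume : MeasureTheory.Measure ℝ),
        s ∉ Set.range fun n : ℕ => √(c n) :=
      hfin.ae_notMem _
    filter_upwards [MeasureTheory.ae_restrict_of_ae hae,
      MeasureTheory.ae_restrict_mem measurableSet_Icc] with s hs hmem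
    have hs0 : 0 < s := hρ.trans_le hmem.1
    rw [← Finset.sum_mul]
    have hne : ∀ n ∈ Finset.range N, ‖1 - (s / √(c n)) ^ 2‖ ≠ 0 := by
      intro n _ h0
      rw [norm_eq_zero, sub_eq_zero, eq_comm,
        pow_eq_one_iff_of_nonneg (by have := hβ n; positivity) two_ne_zero,
        div_eq_one_iff_eq (hβ n).ne'] at h0
      exact hs ⟨n, h0.symm⟩
    rw [← Real.log_prod hne]
    have hprod : ∏ n ∈ Finset.range N, ‖1 - (s / √(c n)) ^ 2‖ ≤ Real.exp L := by
      refine le_trans (le_of_eq (Finset.prod_congr rfl fun n _ => ?_)) (h s hmem.1 hmem.2)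
      rw [div_pow, Real.sq_sqrt (hc n).le]
    have hpos : 0 < ∏ n ∈ Finset.range N, ‖1 - (s / √(c n)) ^ 2‖ :=
      Finset.prod_pos fun n hn => lt_of_le_of_ne (norm_nonneg _) (hne n hn).symm
    gcongr
    exact (Real.log_le_iff_le_exp hpos).2 hprod
  rw [hsum, intervalIntegral.integral_const_mul, integral_two_div_sq hρ hρσ] at hle
  have : L * (2 / ρ - 2 / σ) ≤ 2 * L / ρ := by
    have : 0 ≤ L * (2 / σ) := by positivity
    have e : L * (2 / ρ) = 2 * L / ρ := by ring
    linarith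
  linarith

/-! ### Covering intervals and escaping orbits. -/

/-- If `g` is continuous on `[0, ∞)` and each compact interval `I n` is covered by the image of the
previous one, then some orbit of `g` follows the intervals. -/
lemma exists_orbit_mem_Icc {g : ℝ → ℝ} (hg : ContinuousOn g (Set.Ici 0)) {c s : ℕ → ℝ}
    (hc : ∀ n, 0 ≤ c n) (hcs : ∀ n, c n ≤ s n)
    (hcov : ∀ n, Set.Icc (c (n + 1)) (s (n + 1)) ⊆ g '' Set.Icc (c n) (s n)) :
    ∃ x, ∀ n, g^[n] x ∈ Set.Icc (c n) (s n) := by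
  have hgn : ∀ n, ContinuousOn g (Set.Icc (c n) (s n)) := fun n =>
    hg.mono fun x hx => (hc n).trans hx.1
  let K : ℕ → Set ℝ := fun n => {x | ∀ j ≤ n, g^[j] x ∈ Set.Icc (c j) (s j)}
  have hcont : ∀ n, ContinuousOn (g^[n + 1]) (K n) := by
    intro n
    induction n with
    | zero => exact (hgn 0).mono fun x hx => hx 0 le_rfl
    | succ n ih =>
      rw [Function.iterate_succ']
      refine (hgn (n + 1)).comp (ih.mono fun x hx j hj => hx j (by omega)) ?_
      exact fun x hx => hx (n + 1) le_rfl
  have hclosed : ∀ n, IsClosed (K n) := by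
    intro n
    induction n with
    | zero =>
      have : K 0 = Set.Icc (c 0) (s 0) := by
        ext x; exact ⟨fun h => h 0 le_rfl, fun h j hj => by
          obtain rfl : j = 0 := by omega
          exact h⟩
      rw [this]; exact isClosed_Icc
    | succ n ih =>
      have : K (n + 1) = K n ∩ g^[n + 1] ⁻¹' Set.Icc (c (n + 1)) (s (n + 1)) := by
        ext x
        refine ⟨fun h => ⟨fun j hj => h j (by omega), h (n + 1) le_rfl⟩, fun h j hj => ?_⟩
        rcases Nat.lt_or_ge j (n + 1) with h1 | h1
        · exact h.1 j (by omega)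
        · obtain rfl : j = n + 1 := by omega
          exact h.2
      rw [this]
      exact (hcont n).preimage_isClosed_of_isClosed ih isClosed_Icc
  -- Pulling a point back through the coverings shows that every K n is nonempty; the K n are nested
  -- compact sets.
  have hsurj : ∀ n, ∀ y ∈ Set.Icc (c n) (s n), ∃ x ∈ K n, g^[n] x = y := by
    intro n
    induction n with
    | zero =>
      intro y hy
      refine ⟨y, fun j hj => ?_, rfl⟩
      obtain rfl : j = 0 := by omega
      exact hy
    | succ n ih =>
      intro y hy
      obtain ⟨w, hw, rfl⟩ := hcov n hy
      obtain ⟨x, hx, rfl⟩ := ih w hw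
      refine ⟨x, fun j hj => ?_, Function.iterate_succ_apply' g n x⟩
      rcases Nat.lt_or_ge j (n + 1) with h1 | h1
      · exact hx j (by omega)
      · obtain rfl : j = n + 1 := by omega
        rwa [Function.iterate_succ_apply']
  have hK0 : IsCompact (K 0) :=
    isCompact_Icc.of_isClosed_subset (hclosed 0) fun x hx => hx 0 le_rfl
  obtain ⟨x, hx⟩ := IsCompact.nonempty_iInter_of_sequence_nonempty_isCompact_isClosed K
    (fun n x hx j hj => hx j (by omega))
    (fun n => by
      obtain ⟨x, hx, _⟩ := hsurj n (c n) ⟨le_rfl, hcs n⟩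
      exact ⟨x, hx⟩) hK0 hclosed
  exact ⟨x, fun n => Set.mem_iInter.1 hx n n le_rfl⟩

/-- An orbit tending to infinity exists for a continuous function with arbitrarily large zeros
that exceeds `2 r` somewhere on `[c r, r]`, where `c r` is a zero tending to infinity with `r`. -/
theorem exists_tendsto_iterate_atTop {g c s : ℝ → ℝ} (hg : ContinuousOn g (Set.Ici 0))
    (hc : Tendsto c atTop atTop)
    (h : ∀ᶠ r in atTop, c r ≤ s r ∧ s r ≤ r ∧ g (c r) = 0 ∧ 2 * r ≤ g (s r)) :
    ∃ r, 0 < r ∧ Tendsto (fun n : ℕ => g^[n] r) atTop atTop := by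
  obtain ⟨r₀, hr₀⟩ := eventually_atTop.1 (h.and (hc.eventually_ge_atTop 1))
  -- Doubling matches the factor in 2r ≤ g(s r): the image [0, 2 R n] contains the next interval,
  -- which lies below R (n + 1).
  set R : ℕ → ℝ := fun n => 2 ^ n * max r₀ 1
  have hRge : ∀ n, r₀ ≤ R n := fun n => (le_max_left r₀ 1).trans
    (le_mul_of_one_le_left (by positivity) (one_le_pow₀ one_le_two))
  have hRtop : Tendsto R atTop atTop :=
    (tendsto_pow_atTop_atTop_of_one_lt one_lt_two).atTop_mul_const (by positivity)
  have hall := fun n => hr₀ (R n) (hRge n)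
  have hc0 : ∀ n, 0 < c (R n) := fun n => by linarith [(hall n).2]
  obtain ⟨x, hx⟩ := exists_orbit_mem_Icc (c := fun n => c (R n)) (s := fun n => s (R n)) hg
    (fun n => (hc0 n).le) (fun n => (hall n).1.1) (fun n => by
      obtain ⟨⟨h1, h2, h3, h4⟩, -⟩ := hall n
      have hivt := intermediate_value_Icc h1
        (hg.mono fun x hx => (hc0 n).le.trans hx.1)
      refine subset_trans ?_ hivt
      rw [h3]
      refine Set.Icc_subset_Icc (hc0 (n + 1)).le ?_
      have h5 : R (n + 1) = 2 * R n := by simp only [R, pow_succ]; ring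
      linarith [(hall (n + 1)).1.2.1])
  refine ⟨x, (hc0 0).trans_le (hx 0).1, ?_⟩
  exact tendsto_atTop_mono (fun n => (hx n).1) (hc.comp hRtop)

/-! ### Maximum and minimum modulus; Jensen's inequality. -/

/-- Rescaling to a fixed compact circle moves r into the integrand of the infimum, from which
continuity of m follows. -/
lemma norm_image_sphere_eq (f : ℂ → ℂ) {r : ℝ} (hr : 0 ≤ r) :
    (fun z : ℂ => ‖f z‖) '' Metric.sphere (0 : ℂ) r =
      (fun z : ℂ => ‖f (r * z)‖) '' Metric.sphere (0 : ℂ) 1 := by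
  ext y
  constructor
  · rintro ⟨z, hz, rfl⟩
    rw [mem_sphere_zero_iff_norm] at hz
    rcases hr.eq_or_lt with rfl | hr
    · exact ⟨1, by simp, by simp [norm_eq_zero.1 hz]⟩
    · have hr' : (r : ℂ) ≠ 0 := by exact_mod_cast hr.ne'
      refine ⟨z / r, ?_, ?_⟩
      · rw [mem_sphere_zero_iff_norm, norm_div, hz, Complex.norm_real,
          Real.norm_of_nonneg hr.le, div_self hr.ne']
      · simp only [mul_div_cancel₀ z hr']
  · rintro ⟨z, hz, rfl⟩
    rw [mem_sphere_zero_iff_norm] at hz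
    exact ⟨r * z, by simp [hz, abs_of_nonneg hr], rfl⟩

lemma continuousOn_minModulus {f : ℂ → ℂ} (hf : Continuous f) :
    ContinuousOn (minModulus f) (Set.Ici 0) := by
  have h : Continuous fun r : ℝ => sInf ((fun z : ℂ => ‖f (r * z)‖) '' Metric.sphere (0 : ℂ) 1) :=
    IsCompact.continuous_sInf (f := fun (r : ℝ) (z : ℂ) => ‖f (r * z)‖)
      (isCompact_sphere (0 : ℂ) 1) (by fun_prop)
  refine h.continuousOn.congr fun r hr => ?_
  rw [minModulus, norm_image_sphere_eq f hr]

lemma minModulus_eq_zero {f : ℂ → ℂ} {z : ℂ} (hz : f z = 0) : minModulus f ‖z‖ = 0 := by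
  refine le_antisymm (csInf_le ⟨0, ?_⟩ ⟨z, by simp, by simp [hz]⟩) (Real.sInf_nonneg ?_)
  · rintro _ ⟨w, -, rfl⟩; exact norm_nonneg _
  · rintro _ ⟨w, -, rfl⟩; exact norm_nonneg _

lemma le_minModulus {f : ℂ → ℂ} {r A : ℝ} (hr : 0 ≤ r) (h : ∀ z : ℂ, ‖z‖ = r → A ≤ ‖f z‖) :
    A ≤ minModulus f r := by
  refine le_csInf ⟨_, (r : ℂ), by simp [abs_of_nonneg hr], rfl⟩ ?_
  rintro _ ⟨w, hw, rfl⟩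
  exact h w (mem_sphere_zero_iff_norm.1 hw)

lemma maxModulus_le {f : ℂ → ℂ} {r A : ℝ} (hr : 0 ≤ r) (h : ∀ z : ℂ, ‖z‖ = r → ‖f z‖ ≤ A) :
    maxModulus f r ≤ A := by
  refine csSup_le ⟨_, (r : ℂ), by simp [abs_of_nonneg hr], rfl⟩ ?_
  rintro _ ⟨w, hw, rfl⟩
  exact h w (mem_sphere_zero_iff_norm.1 hw)

lemma norm_le_maxModulus {f : ℂ → ℂ} (hf : Continuous f) (z : ℂ) : ‖f z‖ ≤ maxModulus f ‖z‖ :=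
  le_csSup ((isCompact_sphere (0 : ℂ) ‖z‖).bddAbove_image hf.norm.continuousOn)
    ⟨z, by simp, rfl⟩

/-- Jensen's inequality for a finite product. -/
lemma sum_log_div_le_log_of_norm_partialProd_le {a : ℕ → ℂ} (ha : ∀ n, a n ≠ 0) {r A : ℝ}
    (hr : 0 < r) {N n₁ : ℕ} (hn₁ : n₁ ≤ N) (hA1 : 1 ≤ A)
    (hA : ∀ z : ℂ, ‖z‖ = r → ‖partialProd a N z‖ ≤ A) :
    ∑ n ∈ Finset.range n₁, Real.log (r / ‖a n‖) ≤ Real.log A := by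
  have hna : ∀ n, 0 < ‖a n‖ := fun n => norm_pos_iff.2 (ha n)
  have havg : Real.circleAverage (fun z => Real.log ‖partialProd a N z‖) 0 r =
      ∑ n ∈ Finset.range N, (Real.log r + Real.posLog (r⁻¹ * ‖0 - a n‖) - Real.log ‖a n‖) := by
    have h1 : ∀ n ∈ Finset.range N,
        CircleIntegrable (fun z => Real.log ‖z - a n‖ - Real.log ‖a n‖) 0 r := fun n _ =>
      (circleIntegrable_log_norm_sub_const r).sub (circleIntegrable_const _ _ _)
    have h2 : Real.circleAverage (fun z => Real.log ‖partialProd a N z‖) 0 r =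
        Real.circleAverage
          (fun z => ∑ n ∈ Finset.range N, (Real.log ‖z - a n‖ - Real.log ‖a n‖)) 0 r := by
      -- The logarithm of the product splits only away from its zeros, a finite set that the average
      -- ignores.
      refine Real.circleAverage_congr_codiscreteWithin ?_ hr.ne'
      have hfin : ((Finset.range N).image a : Set ℂ)ᶜ ∈
          codiscreteWithin (Metric.sphere (0 : ℂ) |r|) :=
        compl_finite_mem_codiscreteWithin (Finset.finite_toSet _)
      filter_upwards [hfin] with z hz
      have hza : ∀ n ∈ Finset.range N, ‖z - a n‖ ≠ 0 := fun n hn h => hz <| by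
        rw [norm_eq_zero, sub_eq_zero] at h
        rw [h]
        exact Finset.mem_coe.2 (Finset.mem_image_of_mem a hn)
      have hfac : ∀ n, ‖1 - z / a n‖ = ‖z - a n‖ / ‖a n‖ := fun n => by
        rw [← norm_div, sub_div, div_self (ha n), norm_sub_rev]
      rw [partialProd, norm_prod, Real.log_prod fun n hn => by
        rw [hfac]; exact div_ne_zero (hza n hn) (hna n).ne']
      exact Finset.sum_congr rfl fun n hn => by
        rw [hfac, Real.log_div (hza n hn) (hna n).ne']
    rw [h2, Real.circleAverage_fun_sum h1]
    refine Finset.sum_congr rfl fun n _ => ?_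
    rw [Real.circleAverage_fun_sub (circleIntegrable_log_norm_sub_const r)
      (circleIntegrable_const _ _ _), Real.circleAverage_const,
      circleAverage_log_norm_sub_const_eq_log_radius_add_posLog hr.ne']
  have hle : Real.circleAverage (fun z => Real.log ‖partialProd a N z‖) 0 r ≤ Real.log A := by
    refine Real.circleAverage_mono_on_of_le_circle
      (MeromorphicOn.circleIntegrable_log_norm fun z _ => by unfold partialProd; fun_prop) ?_
    intro z hz
    rw [mem_sphere_zero_iff_norm, abs_of_pos hr] at hz
    rcases (norm_nonneg (partialProd a N z)).eq_or_lt with h0 | h0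
    · rw [← h0, Real.log_zero]; exact Real.log_nonneg hA1
    · exact Real.log_le_log h0 (hA z hz)
  rw [havg] at hle
  refine le_trans ?_ hle
  -- Each term equals max(log(r/|a_n|), 0): it dominates the logarithm where kept and is nonnegative
  -- where dropped.
  refine (Finset.sum_le_sum fun n _ => ?_).trans (Finset.sum_le_sum_of_subset_of_nonneg
    (Finset.range_mono hn₁) fun n _ _ => ?_)
  · rw [Real.log_div hr.ne' (hna n).ne']
    linarith [Real.posLog_nonneg (x := r⁻¹ * ‖0 - a n‖)]
  · have h : Real.log (r⁻¹ * ‖0 - a n‖) ≤ Real.posLog (r⁻¹ * ‖0 - a n‖) := le_max_right _ _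
    rw [zero_sub, norm_neg, Real.log_mul (inv_ne_zero hr.ne') (hna n).ne', Real.log_inv] at h
    rw [zero_sub, norm_neg]
    linarith

/-! ### Regular growth of r^(1/2 - ε(r)). -/

section growth
variable {ε k : ℝ → ℝ}

lemma exists_regular_threshold
    (hε_pos : ∃ r₀ : ℝ, 0 < r₀ ∧ ∀ r : ℝ, r₀ < r → 0 < ε r)
    (hε_zero : Tendsto ε atTop (𝓝 0))
    (hε_decr : ∃ r₀ : ℝ, 0 < r₀ ∧ AntitoneOn ε (Set.Ioi r₀))
    (hk_incr : ∃ r₀ : ℝ, 0 < r₀ ∧ MonotoneOn k (Set.Ioi r₀)) :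
    ∃ r₀ : ℝ, 1 ≤ r₀ ∧ (∀ r, r₀ < r → 0 < ε r ∧ ε r ≤ 1 / 4) ∧ AntitoneOn ε (Set.Ioi r₀) ∧
      MonotoneOn k (Set.Ioi r₀) := by
  obtain ⟨r₁, -, h₁⟩ := hε_pos
  obtain ⟨r₂, -, h₂⟩ := hε_decr
  obtain ⟨r₃, -, h₃⟩ := hk_incr
  obtain ⟨r₄, h₄⟩ := eventually_atTop.1 (hε_zero.eventually_le_const (u := 1 / 4) (by norm_num))
  refine ⟨max (max 1 r₁) (max (max r₂ r₃) r₄), by simp, fun r hr => ?_, h₂.mono fun r hr => ?_,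
    h₃.mono fun r hr => ?_⟩ <;> simp only [max_lt_iff, Set.mem_Ioi] at hr ⊢
  · exact ⟨h₁ r hr.1.2, h₄ r hr.2.2.le⟩
  · exact hr.2.1.1
  · exact hr.2.1.2

lemma rpow_half_sub_eq (hk : ∀ r : ℝ, k r = ε r * Real.log r) {r : ℝ} (hr : 0 < r) :
    r ^ (1 / 2 - ε r) = √r * Real.exp (-k r) := by
  rw [sub_eq_add_neg, Real.rpow_add hr, ← Real.sqrt_eq_rpow, hk,
    Real.rpow_def_of_pos hr (-ε r)]
  congr 2; ring

lemma rpow_half_sub_pow_four {r : ℝ} (hr : 0 < r) :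
    (r ^ (1 / 2 - ε r)) ^ 4 = r * r ^ (1 - 4 * ε r) := by
  rw [← Real.rpow_natCast, ← Real.rpow_mul hr.le,
    show (1 / 2 - ε r) * ((4 : ℕ) : ℝ) = 1 + (1 - 4 * ε r) by push_cast; ring,
    Real.rpow_add hr, Real.rpow_one]

/-- Here φ⁴/r = r^(1 - 4ε(r)), whose exponent increases and is nonnegative because ε ≤ 1/4. -/
lemma rpow_half_sub_four_le {r₀ : ℝ} (hr₀ : 1 ≤ r₀) (hε : ∀ r, r₀ < r → 0 < ε r ∧ ε r ≤ 1 / 4)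
    (hanti : AntitoneOn ε (Set.Ioi r₀)) (t r : ℝ) (ht : r₀ < t) (htr : t ≤ r) :
    (t ^ (1 / 2 - ε t)) ^ 4 * r ≤ t * (r ^ (1 / 2 - ε r)) ^ 4 := by
  have ht0 : 0 < t := by linarith
  have hr0 : 0 < r := by linarith
  rw [rpow_half_sub_pow_four ht0, rpow_half_sub_pow_four hr0]
  have h1 : t ^ (1 - 4 * ε t) ≤ t ^ (1 - 4 * ε r) := by
    have := hanti (Set.mem_Ioi.2 ht) (Set.mem_Ioi.2 (ht.trans_le htr)) htr
    exact Real.rpow_le_rpow_of_exponent_le (by linarith) (by linarith)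
  have h2 : t ^ (1 - 4 * ε r) ≤ r ^ (1 - 4 * ε r) :=
    Real.rpow_le_rpow ht0.le htr (by linarith [(hε r (ht.trans_le htr)).2])
  calc t * t ^ (1 - 4 * ε t) * r = t * (r * t ^ (1 - 4 * ε t)) := by ring
    _ ≤ t * (r * r ^ (1 - 4 * ε r)) := by gcongr; exact h1.trans h2

/-- Here φ²/r = e^(-2k(r)), and k increases. -/
lemma rpow_half_sub_two_le (hk : ∀ r : ℝ, k r = ε r * Real.log r) {r₀ : ℝ} (hr₀ : 1 ≤ r₀)
    (hmono : MonotoneOn k (Set.Ioi r₀)) (r t : ℝ) (hr : r₀ < r) (hrt : r ≤ t) :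
    (t ^ (1 / 2 - ε t)) ^ 2 * r ≤ t * (r ^ (1 / 2 - ε r)) ^ 2 := by
  have hr0 : 0 < r := by linarith
  have ht0 : 0 < t := by linarith
  rw [rpow_half_sub_eq hk hr0, rpow_half_sub_eq hk ht0, mul_pow, mul_pow, Real.sq_sqrt hr0.le,
    Real.sq_sqrt ht0.le]
  have h := hmono (Set.mem_Ioi.2 hr) (Set.mem_Ioi.2 (hr.trans_le hrt)) hrt
  calc t * Real.exp (-k t) ^ 2 * r = t * (r * Real.exp (-k t) ^ 2) := by ring
    _ ≤ t * (r * Real.exp (-k r) ^ 2) := by gcongr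

lemma le_rpow_half_sub_pow_four {r : ℝ} (hr : 1 ≤ r) (hε : ε r ≤ 1 / 4) :
    0 < r ^ (1 / 2 - ε r) ∧ r ≤ (r ^ (1 / 2 - ε r)) ^ 4 := by
  have hr0 : 0 < r := by linarith
  refine ⟨Real.rpow_pos_of_pos hr0 _, ?_⟩
  rw [rpow_half_sub_pow_four hr0]
  exact le_mul_of_one_le_right hr0.le (Real.one_le_rpow hr (by linarith))

/-- A positive increasing `k` with `k r ≥ C k ((log r) ^ (2 d))`, `C > 1`, is unbounded. -/
lemma tendsto_atTop_of_mul_comp_le {C : ℝ} {u : ℝ → ℝ} (hC : 1 < C) (hu : Tendsto u atTop atTop)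
    (hpos : ∀ᶠ r in atTop, 0 < k r) {r₀ : ℝ} (hmono : MonotoneOn k (Set.Ioi r₀))
    (hcrit : ∀ᶠ r in atTop, C * k (u r) ≤ k r) : Tendsto k atTop atTop := by
  have hm : Monotone fun r => k (max r (r₀ + 1)) := fun r s hrs =>
    hmono (by simp) (by simp) (max_le_max_right _ hrs)
  have heq : (fun r => k (max r (r₀ + 1))) =ᶠ[atTop] k := by
    filter_upwards [eventually_ge_atTop (r₀ + 1)] with r hr
    rw [max_eq_left hr]
  rcases tendsto_atTop_of_monotone hm with h | ⟨l, h⟩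
  · exact h.congr' heq
  -- A finite limit l of k would be positive and satisfy C l ≤ l.
  · exfalso
    have hl : Tendsto k atTop (𝓝 l) := h.congr' heq
    have h1 : C * l ≤ l := le_of_tendsto_of_tendsto ((hl.comp hu).const_mul C) hl hcrit
    obtain ⟨r, hr1, hr2⟩ := (hpos.and heq).exists
    have h2 : k r ≤ l := by
      have := hm.ge_of_tendsto h r
      rwa [← hr2]
    nlinarith

end growth

/-! ### From zero counts to bounds on the moduli of f. -/

lemma eventually_bounds_of_isEquivalent {u v : ℝ → ℝ} (h : Asymptotics.IsEquivalent atTop u v)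
    (hv : ∀ᶠ r in atTop, 0 < v r) {δ : ℝ} (hδ : 0 < δ) :
    ∀ᶠ r in atTop, (1 - δ) * v r ≤ u r ∧ u r ≤ (1 + δ) * v r := by
  filter_upwards [h.isLittleO.bound hδ, hv] with r hr hvr
  rw [Pi.sub_apply, Real.norm_eq_abs, Real.norm_of_nonneg hvr.le, abs_le] at hr
  constructor <;> linarith [hr.1, hr.2]

lemma sum_range_indicator_lt {m M : ℕ} (h : m ≤ M) :
    ∑ n ∈ Finset.range M, (if n < m then (1 : ℝ) else 0) = m := by
  rw [Finset.sum_boole]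
  congr 1
  have : (Finset.range M).filter (· < m) = Finset.range m := by
    ext i; simp only [Finset.mem_filter, Finset.mem_range]; omega
  rw [this, Finset.card_range]

/-- `∑ log (r / c n)` is bounded below by counting at the radii `r / 4`, `r / 16`, `r / 64`. -/
lemma log_four_mul_count_le_sum_log {c : ℕ → ℝ} {N : ℝ → ℕ} (hc : ∀ n, 0 < c n)
    (hmono : Monotone N) (hN : ∀ n t, c n ≤ t ↔ n < N t) {r : ℝ} (hr : 0 < r) :
    Real.log 4 * (N (r / 4) + N (r / 16) + N (r / 64)) ≤
      ∑ n ∈ Finset.range (N r), Real.log (r / c n) := by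
  have h4 := sum_range_indicator_lt (hmono (show r / 4 ≤ r by linarith))
  have h16 := sum_range_indicator_lt (hmono (show r / 16 ≤ r by linarith))
  have h64 := sum_range_indicator_lt (hmono (show r / 64 ≤ r by linarith))
  rw [← h4, ← h16, ← h64, ← Finset.sum_add_distrib, ← Finset.sum_add_distrib, Finset.mul_sum]
  have hL : 0 < Real.log 4 := Real.log_pos (by norm_num)
  -- A zero of modulus at most r/4^j contributes at least j log 4, one log 4 for each of the three
  -- radii it lies below.
  have hpow : ∀ n j : ℕ, c n ≤ r / 4 ^ j → j * Real.log 4 ≤ Real.log (r / c n) := fun n j h => by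
    rw [← Real.log_pow]
    refine Real.log_le_log (by positivity) ?_
    rw [le_div_iff₀ (hc n)]
    rw [le_div_iff₀ (by positivity)] at h
    linarith
  have hind : ∀ p : Prop, ∀ [Decidable p], (if p then (1 : ℝ) else 0) ≤ 1 := fun p _ => by
    split_ifs <;> norm_num
  refine Finset.sum_le_sum fun n hn => ?_
  have hnr := (hN n r).2 (Finset.mem_range.1 hn)
  have i4 := hind (n < N (r / 4))
  have i16 := hind (n < N (r / 16))
  have i64 := hind (n < N (r / 64))
  rcases le_or_gt (c n) (r / 64) with h | h
  · have := hpow n 3 (by norm_num; exact h)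
    push_cast at this
    nlinarith
  rw [if_neg fun h' => not_le.2 h ((hN _ _).2 h')]
  rcases le_or_gt (c n) (r / 16) with h | h
  · have := hpow n 2 (by norm_num; exact h)
    push_cast at this
    nlinarith
  rw [if_neg fun h' => not_le.2 h ((hN _ _).2 h')]
  rcases le_or_gt (c n) (r / 4) with h | h
  · have := hpow n 1 (by norm_num; exact h)
    push_cast at this
    nlinarith
  rw [if_neg fun h' => not_le.2 h ((hN _ _).2 h')]
  have := hpow n 0 (by simpa using hnr)
  push_cast at this
  linarith

section entire
variable {a : ℕ → ℂ} {f : ℂ → ℂ}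

/-- Upper bound for the maximum modulus of a product in terms of the moduli of its zeros. -/
lemma log_maxModulus_le {r S : ℝ} (hr : 0 ≤ r)
    (hf_prod : ∀ z : ℂ,
      Tendsto (fun N : ℕ => ∏ n ∈ Finset.range N, (1 - z / a n)) atTop (𝓝 (f z)))
    (hS0 : 0 ≤ S)
    (hS : ∀ M : ℕ, ∑ n ∈ Finset.range M, Real.log (1 + r / ‖a n‖) ≤ S) :
    Real.log (maxModulus f r) ≤ S := by
  have h : maxModulus f r ≤ Real.exp S := by
    refine maxModulus_le hr fun z hz => le_of_tendsto' (hf_prod z).norm fun M => ?_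
    rw [norm_prod]
    calc ∏ n ∈ Finset.range M, ‖1 - z / a n‖
        ≤ ∏ n ∈ Finset.range M, (1 + r / ‖a n‖) := by
          refine Finset.prod_le_prod (fun _ _ => norm_nonneg _) fun n _ => ?_
          refine (norm_sub_le _ _).trans ?_
          rw [norm_one, norm_div, hz]
      _ = Real.exp (∑ n ∈ Finset.range M, Real.log (1 + r / ‖a n‖)) := by
          rw [Real.exp_sum]
          exact Finset.prod_congr rfl fun n _ => (Real.exp_log (by positivity)).symm
      _ ≤ Real.exp S := Real.exp_le_exp.2 (hS M)
  rcases lt_or_ge 0 (maxModulus f r) with h0 | h0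
  · exact (Real.log_le_iff_le_exp h0).2 h
  · have h1 : 0 ≤ maxModulus f r := Real.sSup_nonneg <| by
      rintro _ ⟨w, -, rfl⟩; exact norm_nonneg _
    rw [le_antisymm h0 h1, Real.log_zero]
    exact hS0

/-- Lower bound for the maximum modulus, a form of Jensen's inequality. -/
lemma sum_log_le_log_maxModulus (hf : Continuous f) (ha : ∀ n, a n ≠ 0)
    (hf_prod : ∀ z : ℂ,
      Tendsto (fun N : ℕ => ∏ n ∈ Finset.range N, (1 - z / a n)) atTop (𝓝 (f z)))
    (hsum : Summable fun n => 1 / ‖a n‖) {r : ℝ} (hr : 0 < r) (n₁ : ℕ)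
    (hpos : 0 < ∑ n ∈ Finset.range n₁, Real.log (r / ‖a n‖)) :
    ∑ n ∈ Finset.range n₁, Real.log (r / ‖a n‖) ≤ Real.log 2 + Real.log (maxModulus f r) := by
  obtain ⟨N₀, hN₀⟩ := half_norm_partialProd_le hf_prod hsum r hr.le
  have h := sum_log_div_le_log_of_norm_partialProd_le ha hr (le_max_right N₀ n₁)
    (le_max_right (2 * maxModulus f r) 1) (fun z hz => by
      have h1 := hN₀ _ (le_max_left N₀ n₁) z hz.le
      have h2 := norm_le_maxModulus hf z
      rw [hz] at h2
      exact le_max_of_le_left (by linarith))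
  -- The truncation at 1 is inactive, since otherwise Jensen's sum would be nonpositive.
  have hM : 1 < 2 * maxModulus f r := by
    by_contra! hle
    rw [max_eq_right hle, Real.log_one] at h
    linarith
  rwa [max_eq_left hM.le, Real.log_mul (by norm_num) (by linarith)] at h

/-- If the minimum modulus stays below `2 r` on `[ρ ^ 2, r]`, the truncated sums at `ρ` and `√r`
are comparable. -/
lemma sum_truncKernel_le_of_minModulus_lt (ha : ∀ n, a n ≠ 0)
    (hf_prod : ∀ z : ℂ,
      Tendsto (fun N : ℕ => ∏ n ∈ Finset.range N, (1 - z / a n)) atTop (𝓝 (f z)))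
    (hsum : Summable fun n => 1 / ‖a n‖) {r ρ : ℝ} (hr : 1 ≤ r) (hρ : 0 < ρ) (hρr : ρ ^ 2 ≤ r)
    (hmin : ∀ t, ρ ^ 2 ≤ t → t ≤ r → minModulus f t < 2 * r) :
    ∃ N₀ : ℕ, ∀ N ≥ N₀, ρ⁻¹ * ∑ n ∈ Finset.range N, truncKernel (ρ / √‖a n‖) ≤
      (√r)⁻¹ * ∑ n ∈ Finset.range N, truncKernel (√r / √‖a n‖) + 2 * Real.log (4 * r) / ρ := by
  have hr0 : 0 < r := by linarith
  obtain ⟨N₀, hN₀⟩ := half_norm_partialProd_le hf_prod hsum r hr0.le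
  refine ⟨N₀, fun N hN => sum_truncKernel_le (fun n => norm_pos_iff.2 (ha n)) hρ
    (Real.le_sqrt_of_sq_le hρr) (Real.log_nonneg (by linarith)) N fun s hs hsr => ?_⟩
  rw [Real.exp_log (by linarith)]
  have hs0 : 0 < s := hρ.trans_le hs
  have hsr2 : s ^ 2 ≤ r := (Real.le_sqrt hs0.le hr0.le).1 hsr
  by_contra! hlt
  refine absurd (hmin (s ^ 2) (by gcongr) hsr2) (not_lt.2 ?_)
  refine le_minModulus (by positivity) fun z hz => ?_
  have h1 := hN₀ N hN z (by rw [hz]; exact hsr2)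
  -- On a circle each factor is smallest when z has the argument of a_n, so the product is bounded
  -- below by the one with positive zeros.
  have h2 : ∏ n ∈ Finset.range N, ‖1 - s ^ 2 / ‖a n‖‖ ≤ ‖partialProd a N z‖ := by
    rw [partialProd, norm_prod]
    refine Finset.prod_le_prod (fun _ _ => norm_nonneg _) fun n _ => ?_
    have := abs_norm_sub_norm_le (1 : ℂ) (z / a n)
    rwa [norm_one, norm_div, hz] at this
  linarith

end entire

lemma card_mul_le_sum_truncKernel {c : ℕ → ℝ} (hc : ∀ n, 0 < c n) {ρ : ℝ} (hρ : 0 < ρ) {m N : ℕ}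
    (hm : ∀ n < m, c n ≤ ρ ^ 2) (hmN : m ≤ N) :
    m * (4 * Real.log 2) ≤ ∑ n ∈ Finset.range N, truncKernel (ρ / √(c n)) := by
  calc m * (4 * Real.log 2) = ∑ n ∈ Finset.range m, 4 * Real.log 2 := by simp
    _ ≤ ∑ n ∈ Finset.range m, truncKernel (ρ / √(c n)) := by
      refine Finset.sum_le_sum fun n hn => four_mul_log_two_le_truncKernel ?_
      rw [one_le_div (Real.sqrt_pos.2 (hc n))]
      exact Real.sqrt_le_iff.2 ⟨hρ.le, hm n (Finset.mem_range.1 hn)⟩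
    _ ≤ _ := Finset.sum_le_sum_of_subset_of_nonneg (Finset.range_mono hmN)
      fun n _ _ => truncKernel_nonneg (by positivity)

lemma sum_truncKernel_sqrt_le {c : ℕ → ℝ} (hc : ∀ n, 0 < c n) {r : ℝ} (hr : 0 ≤ r) (N : ℕ) :
    ∑ n ∈ Finset.range N, truncKernel (√r / √(c n)) ≤
      16 * ∑ n ∈ Finset.range N, Real.log (1 + r / c n) := by
  rw [Finset.mul_sum]
  refine Finset.sum_le_sum fun n _ => (truncKernel_le (by positivity)).trans (le_of_eq ?_)
  rw [div_pow, Real.sq_sqrt hr, Real.sq_sqrt (hc n).le]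

/-- For large `r` the decay of `exp (-k)` between `(log r) ^ (2 d)` and `r` beats both error
terms. -/
lemma eventually_exp_neg_gt {ε k : ℝ → ℝ} (hk : ∀ r : ℝ, k r = ε r * Real.log r)
    (hε_zero : Tendsto ε atTop (𝓝 0)) {C d : ℝ} (hC : 1 < C) (hd : 1 < d)
    (hktop : Tendsto k atTop atTop)
    (hcrit : ∀ᶠ r in atTop, C * k (Real.log r ^ (2 * d)) ≤ k r) (K : ℝ) (hK : 0 < K) :
    ∀ᶠ r in atTop, 16 * K * Real.exp (-k r) + 2 * Real.log (4 * r) / Real.log r ^ d <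
      Real.exp (-k (Real.log r ^ (2 * d))) := by
  have hlog := Real.tendsto_log_atTop
  have hu : Tendsto (fun r => Real.log r ^ (2 * d)) atTop atTop :=
    (tendsto_rpow_atTop (by linarith)).comp hlog
  have hku := hktop.comp hu
  have hexp : Tendsto (fun r => Real.exp (-((C - 1) * k (Real.log r ^ (2 * d))))) atTop (𝓝 0) :=
    Real.tendsto_exp_neg_atTop_nhds_zero.comp (hku.const_mul_atTop (by linarith))
  have hpow : Tendsto (fun r => Real.log r ^ ((d - 1) / 2)) atTop atTop :=
    (tendsto_rpow_atTop (by linarith)).comp hlog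
  have hε : ∀ᶠ r in atTop, ε (Real.log r ^ (2 * d)) ≤ (d - 1) / (4 * d) :=
    (hε_zero.comp hu).eventually_le_const (by apply div_pos <;> linarith)
  filter_upwards [hcrit, hexp.eventually_lt_const (u := 1 / (64 * K)) (by positivity),
    hpow.eventually_ge_atTop 32, hε, hlog.eventually_ge_atTop (Real.log 4),
    hlog.eventually_gt_atTop 1, eventually_gt_atTop 0] with r h1 h2 h3 h4 h5 h6 h7
  set x := Real.log r
  have hx : 0 < x := by linarith
  have hE := Real.exp_pos (-k (x ^ (2 * d)))
  have e1 : 16 * K * Real.exp (-k r) ≤ 1 / 4 * Real.exp (-k (x ^ (2 * d))) := by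
    calc 16 * K * Real.exp (-k r)
        ≤ 16 * K * (Real.exp (-((C - 1) * k (x ^ (2 * d)))) * Real.exp (-k (x ^ (2 * d)))) := by
          rw [← Real.exp_add]; gcongr; linarith
      _ ≤ 16 * K * (1 / (64 * K) * Real.exp (-k (x ^ (2 * d)))) := by gcongr
      _ = _ := by field_simp; norm_num
  -- As ε → 0, k(x^(2d)) = 2d ε(x^(2d)) log x is eventually at most ((d - 1)/2) log x.
  have e2 : x ^ (-((d - 1) / 2)) ≤ Real.exp (-k (x ^ (2 * d))) := by
    rw [Real.rpow_def_of_pos hx, hk, Real.log_rpow hx]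
    refine Real.exp_le_exp.2 ?_
    have hlx : 0 < Real.log x := Real.log_pos h6
    have h8 : ε (x ^ (2 * d)) * (2 * d) ≤ (d - 1) / 2 := by
      calc ε (x ^ (2 * d)) * (2 * d) ≤ (d - 1) / (4 * d) * (2 * d) := by gcongr
        _ = _ := by field_simp; norm_num
    nlinarith
  -- The left side is at most 4x^(1-d) = 4y⁻², with y = x^((d-1)/2) ≥ 32.
  have e3 : 2 * Real.log (4 * r) / x ^ d ≤ 1 / 8 * x ^ (-((d - 1) / 2)) := by
    have h9 : Real.log (4 * r) ≤ 2 * x := by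
      rw [Real.log_mul (by norm_num) h7.ne']; linarith
    have h10 : x ^ d = x * x ^ ((d - 1) / 2) * x ^ ((d - 1) / 2) := by
      nth_rewrite 2 [← Real.rpow_one x]
      rw [← Real.rpow_add hx, ← Real.rpow_add hx]
      congr 1; ring
    rw [div_le_iff₀ (by positivity), h10, Real.rpow_neg hx.le]
    set y := x ^ ((d - 1) / 2)
    have hy : 0 < y := by linarith
    calc 2 * Real.log (4 * r) ≤ 4 * x := by linarith
      _ ≤ 1 / 8 * (x * y) := by nlinarith
      _ = 1 / 8 * y⁻¹ * (x * y * y) := by field_simp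
  linarith

/-! ### Assembly of both conclusions. -/

theorem theorem2p3 (ε k : ℝ → ℝ)
    (hk : ∀ r : ℝ, k r = ε r * Real.log r)
    (hε_pos : ∃ r₀ : ℝ, 0 < r₀ ∧ ∀ r : ℝ, r₀ < r → 0 < ε r)
    (hε_zero : Tendsto ε atTop (𝓝 0))
    (hk_crit : ∃ C d r₂ : ℝ, 1 < C ∧ 1 < d ∧ 0 < r₂ ∧
      ∀ r : ℝ, r₂ < r → C * k ((Real.log r) ^ (2 * d)) ≤ k r)
    (hε_decr : ∃ r₀ : ℝ, 0 < r₀ ∧ AntitoneOn ε (Set.Ioi r₀))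
    (hk_incr : ∃ r₀ : ℝ, 0 < r₀ ∧ MonotoneOn k (Set.Ioi r₀))
    (f : ℂ → ℂ) (hf : IsTranscendentalEntire f)
    (a : ℕ → ℂ) (ha_pos : 0 < ‖a 0‖) (ha_mono : StrictMono (fun n : ℕ => ‖a n‖))
    (hf_prod : ∀ z : ℂ,
      Tendsto (fun N : ℕ => ∏ n ∈ Finset.range N, (1 - z / a n)) atTop (𝓝 (f z)))
    (hn : Asymptotics.IsEquivalent atTop
      (fun r : ℝ => (zeroCount f r : ℝ)) (fun r : ℝ => r ^ (1 / 2 - ε r))) :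
    (∃ A B R : ℝ, 1 < A ∧ A < B ∧ 0 < R ∧ ∀ r : ℝ, R < r →
      A * r ^ (1 / 2 - ε r) ≤ Real.log (maxModulus f r) ∧
      Real.log (maxModulus f r) ≤ B * r ^ (1 / 2 - ε r)) ∧
    (∃ r : ℝ, 0 < r ∧ Tendsto (fun n : ℕ => (minModulus f)^[n] r) atTop atTop) := by
  obtain ⟨r₀, hr₀, hε, hanti, hmono⟩ :=
    exists_regular_threshold hε_pos hε_zero hε_decr hk_incr
  have hφ : ∀ r, r₀ < r → 0 < r ^ (1 / 2 - ε r) ∧ r ≤ (r ^ (1 / 2 - ε r)) ^ 4 := fun r hr =>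
    le_rpow_half_sub_pow_four (by linarith) (hε r hr).2
  have hφ_two := rpow_half_sub_two_le hk hr₀ hmono
  have hφ_pos : ∀ᶠ r : ℝ in atTop, 0 < r ^ (1 / 2 - ε r) := by
    filter_upwards [eventually_gt_atTop r₀] with r hr using (hφ r hr).1
  have hcount := eventually_bounds_of_isEquivalent hn hφ_pos (δ := 1 / 20) (by norm_num)
  have hfd := hf.1
  have hne : ∀ n, a n ≠ 0 := fun n => norm_pos_iff.1 (norm_pos_of_strictMono ha_pos ha_mono n)
  have hcpos : ∀ n, 0 < ‖a n‖ := norm_pos_of_strictMono ha_pos ha_mono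
  have hsum : Summable fun n => 1 / ‖a n‖ := by
    refine summable_inv_norm_roots hfd ha_pos ha_mono hf_prod ?_
    filter_upwards [hcount, eventually_gt_atTop r₀] with r h1 hr
    have h2 : r ^ (1 / 2 - ε r) ≤ √r := by
      rw [Real.sqrt_eq_rpow]
      exact Real.rpow_le_rpow_of_exponent_le (by linarith) (by linarith [(hε r hr).1])
    linarith [(hφ r hr).1]
  have hN := norm_root_le_iff_lt_zeroCount hfd ha_pos ha_mono hf_prod hsum
  have hNmono : Monotone (zeroCount f) := fun s t hst => by
    by_contra! h
    exact lt_irrefl _ ((hN _ t).1 (((hN _ s).2 h).trans hst))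
  obtain ⟨K, R₁, hK, hKR⟩ := exists_sum_log_one_add_le hcpos ha_mono.monotone hN (by linarith)
    (rpow_half_sub_four_le hr₀ hε hanti) hφ_two hφ (by
      filter_upwards [hcount, hφ_pos] with r h1 h2; linarith)
  refine ⟨?_, ?_⟩
  · obtain ⟨R₂, hR₂⟩ := eventually_atTop.1 hcount
    -- The factor 64 keeps r/64 in the regular range. Also r > 14⁴ gives φ(r) ≥ 14, so 1.15 φ - log
    -- 2 ≥ 1.1 φ.
    refine ⟨11 / 10, max 2 K, max R₁ (max (64 * max r₀ R₂) (14 ^ 4)), by norm_num,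
      lt_max_of_lt_left (by norm_num), by positivity, fun r hr => ⟨?_, ?_⟩⟩
    all_goals
      simp only [max_lt_iff] at hr
      obtain ⟨hr1, hr2, hr3⟩ := hr
      have hrpos : 0 < r := by linarith
      have hr4 : 64 * r₀ < r := lt_of_le_of_lt (by gcongr; exact le_max_left _ _) hr2
      obtain ⟨hφr, hφr4⟩ := hφ r (by linarith)
    -- Since φ²/r decreases, q φ(r/q²) ≥ φ(r). Taking q = 2, 4, 8 gives 7/8 · 19/20 · log 4 > 1.15.
    · have hdiv : ∀ q : ℝ, 1 ≤ q → q ≤ 8 →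
          19 / 20 * r ^ (1 / 2 - ε r) ≤ q * zeroCount f (r / q ^ 2) := by
        intro q hq1 hq8
        have hq2 : q ^ 2 ≤ 64 := by nlinarith
        have hlow : max r₀ R₂ < r / q ^ 2 := by
          rw [lt_div_iff₀ (by positivity)]
          have : 0 ≤ max r₀ R₂ := le_max_of_le_left (by linarith)
          nlinarith
        have h1 := (hR₂ (r / q ^ 2) ((le_max_right _ _).trans hlow.le)).1
        have h2 := hφ_two (r / q ^ 2) r ((le_max_left _ _).trans_lt hlow)
          (div_le_self hrpos.le (one_le_pow₀ hq1))
        have h3 := (hφ (r / q ^ 2) ((le_max_left _ _).trans_lt hlow)).1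
        set y := (r / q ^ 2) ^ (1 / 2 - ε (r / q ^ 2))
        have h4 : (r ^ (1 / 2 - ε r)) ^ 2 ≤ (q * y) ^ 2 := by
          have h5 : (r ^ (1 / 2 - ε r)) ^ 2 * (r / q ^ 2) =
              r * ((r ^ (1 / 2 - ε r)) ^ 2 / q ^ 2) := by ring
          rw [h5] at h2
          have h6 := le_of_mul_le_mul_left h2 hrpos
          rw [div_le_iff₀ (by positivity)] at h6
          linarith [mul_pow q y 2]
        have h7 := le_of_sq_le_sq h4 (by positivity)
        nlinarith
      have d2 := hdiv 2 (by norm_num) (by norm_num)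
      have d4 := hdiv 4 (by norm_num) (by norm_num)
      have d8 := hdiv 8 (by norm_num) (by norm_num)
      norm_num at d2 d4 d8
      have hj := log_four_mul_count_le_sum_log hcpos hNmono hN hrpos
      have hl2 := Real.log_two_gt_d9
      have hl2' := Real.log_two_lt_d9
      have hl4 : Real.log 4 = 2 * Real.log 2 := by
        rw [show (4 : ℝ) = 2 ^ 2 by norm_num, Real.log_pow]; norm_num
      set y := r ^ (1 / 2 - ε r)
      have hy : 14 ≤ y := le_of_lt (lt_of_pow_lt_pow_left₀ 4 hφr.le (hr3.trans_le hφr4))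
      have hs : 7 / 8 * (19 / 20) * y ≤
          zeroCount f (r / 4) + zeroCount f (r / 16) + zeroCount f (r / 64) := by
        linarith
      have hs2 : 115 / 100 * y ≤ ∑ n ∈ Finset.range (zeroCount f r), Real.log (r / ‖a n‖) := by
        refine le_trans ?_ hj
        rw [hl4]
        nlinarith
      have := sum_log_le_log_maxModulus hfd.continuous hne hf_prod hsum hrpos _
        (lt_of_lt_of_le (by positivity) hs2)
      linarith
    · refine log_maxModulus_le hrpos.le hf_prod (by positivity) fun M => ?_
      refine (hKR r hr1 M).trans ?_
      gcongr
      exact le_max_right _ _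
  · obtain ⟨C, d, r₂, hC, hd, -, hcrit⟩ := hk_crit
    have hlog := Real.tendsto_log_atTop
    have hu : Tendsto (fun r => Real.log r ^ (2 * d)) atTop atTop :=
      (tendsto_rpow_atTop (by linarith)).comp hlog
    have hcrit' : ∀ᶠ r in atTop, C * k (Real.log r ^ (2 * d)) ≤ k r := by
      filter_upwards [eventually_gt_atTop r₂] with r hr using hcrit r hr
    have hktop : Tendsto k atTop atTop := by
      refine tendsto_atTop_of_mul_comp_le hC hu ?_ hmono hcrit'
      filter_upwards [eventually_gt_atTop r₀] with r hr
      rw [hk]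
      exact mul_pos (hε r hr).1 (Real.log_pos (by linarith))
    have hur : ∀ᶠ r in atTop, Real.log r ^ (2 * d) ≤ r := by
      filter_upwards [(isLittleO_log_rpow_rpow_atTop (2 * d) one_pos).bound one_pos,
        eventually_gt_atTop 1] with r h1 h2
      rw [Real.rpow_one, one_mul, Real.norm_of_nonneg (Real.rpow_nonneg (Real.log_nonneg h2.le) _),
        Real.norm_of_nonneg (by linarith)] at h1
      exact h1
    have hkey : ∀ᶠ r in atTop, ∃ t, Real.log r ^ (2 * d) ≤ t ∧ t ≤ r ∧
        2 * r ≤ minModulus f t := by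
      filter_upwards [eventually_exp_neg_gt hk hε_zero hC hd hktop hcrit' K hK, hur,
        eventually_gt_atTop R₁, eventually_gt_atTop 1, hu.eventually hcount,
        hu.eventually_gt_atTop r₀] with r h1 h2 h3 h4 h5 h6
      by_contra! hcon
      have hrpos : 0 < r := by linarith
      have hx : 0 < Real.log r := Real.log_pos h4
      have hρ : 0 < Real.log r ^ d := Real.rpow_pos_of_pos hx d
      have hρ2 : (Real.log r ^ d) ^ 2 = Real.log r ^ (2 * d) := by
        rw [← Real.rpow_natCast, ← Real.rpow_mul hx.le]; congr 1; push_cast; ring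
      have hφu := rpow_half_sub_eq hk (r := Real.log r ^ (2 * d)) (by linarith)
      have hφr := rpow_half_sub_eq hk hrpos
      rw [← hρ2] at h1 h2 h5 h6 hφu hcon
      set ρ := Real.log r ^ d
      obtain ⟨N₀, hN₀⟩ := sum_truncKernel_le_of_minModulus_lt hne hf_prod hsum h4.le hρ h2 hcon
      set N := max N₀ (zeroCount f (ρ ^ 2))
      have hmain := hN₀ N (le_max_left _ _)
      have hlow := card_mul_le_sum_truncKernel hcpos hρ (fun n hn => (hN n (ρ ^ 2)).2 hn)
        (le_max_right N₀ _)
      have hupp := (sum_truncKernel_sqrt_le hcpos hrpos.le N).trans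
        (mul_le_mul_of_nonneg_left (hKR r h3 N) (by norm_num))
      rw [Real.sqrt_sq hρ.le] at hφu
      -- The count is at least (19/20) φ(ρ²), and 4 log 2 · 19/20 > 1.
      have hlow' : ρ * Real.exp (-k (ρ ^ 2)) ≤
          ∑ n ∈ Finset.range N, truncKernel (ρ / √‖a n‖) := by
        refine le_trans ?_ hlow
        rw [← hφu]
        have hl2 := Real.log_two_gt_d9
        have h7 := (hφ (ρ ^ 2) h6).1
        nlinarith [h5.1]
      have hsr : 0 < √r := Real.sqrt_pos.2 hrpos
      have e1 : Real.exp (-k (ρ ^ 2)) ≤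
          ρ⁻¹ * ∑ n ∈ Finset.range N, truncKernel (ρ / √‖a n‖) := by
        rwa [inv_mul_eq_div, le_div_iff₀ hρ, mul_comm]
      have e2 : (√r)⁻¹ * ∑ n ∈ Finset.range N, truncKernel (√r / √‖a n‖) ≤
          16 * K * Real.exp (-k r) := by
        rw [inv_mul_eq_div, div_le_iff₀ hsr]
        rw [hφr] at hupp
        linarith
      linarith
    obtain ⟨s, hs⟩ := hkey.choice
    have hNtop : Tendsto (fun t => zeroCount f t - 1) atTop atTop := by
      refine tendsto_atTop.2 fun m => ?_
      filter_upwards [eventually_ge_atTop ‖a m‖] with t ht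
      have := (hN m t).1 ht
      omega
    refine exists_tendsto_iterate_atTop (continuousOn_minModulus hfd.continuous)
      -- With indexing from 0, this is the last zero of modulus at most (log r)^(2d).
      (c := fun r => ‖a (zeroCount f (Real.log r ^ (2 * d)) - 1)‖) (s := s)
      ((tendsto_norm_roots hfd ha_pos ha_mono hf_prod).comp (hNtop.comp hu)) ?_
    filter_upwards [hs, hu.eventually_ge_atTop ‖a 0‖] with r hr h0
    have h1 := (hN 0 _).1 h0
    refine ⟨((hN _ _).2 (by omega)).trans hr.1, hr.2.1, ?_, hr.2.2⟩
    exact minModulus_eq_zero (eval_root_of_tendsto_prod hf_prod (hne _))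

end
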